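/- Let $\varphi=\frac{2}{1+\sqrt5}$. An instance of $\mathsf{MaxSUB}$ consists of integers $0\le K\le n$, a rational $n\times n$ matrix $A=(a_{ij})$ with non-positive off-diagonal entries, non-negative rational vectors $p_1,\dots,p_K\in\mathbb{Q}_+^n$, and a rational number $C>0$; the problem is $$\max\Big\{x^\top A x \;:\; x\in\{0,1\}^n,\ \sum_{k=1}^K (p_k^\top x)^2\le C\Big\},$$ and $\mathrm{OPT}$ denotes its optimal value. Assume that the objective is non-negative, in the following sense: $x^\top Ax\ge 0$ for every $x\in\{0,1\}^n$ with $x_i=0$ for all $i$ such that $a_{ii}<0$ (such variables can be fixed to $0$ without changing $\mathrm{OPT}$). There are an absolute constant $M>0$ and a single deterministic algorithm which, given any such instance and any rational $\epsilon>0$, outputs a feasible $x\in\{0,1\}^n$ with $$x^\top A x\ \ge\ \Big(\frac{\varphi^2}{2e}-M\epsilon\Big)\cdot \mathrm{OPT},$$ in time polynomial in the binary length of the input (the instance and $\epsilon$) and in $1/\epsilon$. That is, there is a $\big(\frac{\varphi^2}{2e}-O(\epsilon)\big)$-approximation algorithm for $\mathsf{MaxSUB}$. Running time is measured on a random access machine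 over the integers with logarithmic cost. -/

import Mathlib

/-! ### A random access machine with logarithmic cost -/

namespace RAM

/-- The memory: integer tables, numbered by `ℕ`, whose cells are addressed by pairs of integers. -/
abbrev Memory := ℕ → ℤ → ℤ → ℤ

/-- Expressions. A table number is a fixed part of the program text; addresses are computed.
`div` is integer division (`Int.ediv`, with `x / 0 = 0`). -/
inductive Expr : Type
  | const (z : ℤ) : Expr
  | load (t : ℕ) (i j : Expr) : Expr
  | add (a b : Expr) : Expr
  | sub (a b : Expr) : Expr
  | mul (a b : Expr) : Expr
  | div (a b : Expr) : Expr

/-- The value of an expression. -/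
def Expr.eval (s : Memory) : Expr → ℤ
  | .const z => z
  | .load t i j => s t (i.eval s) (j.eval s)
  | .add a b => a.eval s + b.eval s
  | .sub a b => a.eval s - b.eval s
  | .mul a b => a.eval s * b.eval s
  | .div a b => a.eval s / b.eval s

/-- Number of binary digits of `|z|`. -/
def bitLength (z : ℤ) : ℕ := Nat.size z.natAbs

/-- The cost of evaluating an expression: every constant, memory access (whose addresses are
themselves charged for) and arithmetic operation costs one plus the bit length of its result. -/
def Expr.cost (s : Memory) : Expr → ℕ
  | .const z => 1 + bitLength z
  | .load t i j => i.cost s + j.cost s + (1 + bitLength (s t (i.eval s) (j.eval s)))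
  | .add a b => a.cost s + b.cost s + (1 + bitLength (a.eval s + b.eval s))
  | .sub a b => a.cost s + b.cost s + (1 + bitLength (a.eval s - b.eval s))
  | .mul a b => a.cost s + b.cost s + (1 + bitLength (a.eval s * b.eval s))
  | .div a b => a.cost s + b.cost s + (1 + bitLength (a.eval s / b.eval s))

/-- Programs. Tests ask whether the value of an expression is positive. -/
inductive Program : Type
  | skip : Program
  | store (t : ℕ) (i j e : Expr) : Program
  | seq (c d : Program) : Program
  | ite (e : Expr) (c d : Program) : Program
  | loop (e : Expr) (c : Program) : Program

/-- The memory after writing `v` into cell `(i, j)` of table `t`. -/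
def Memory.write (s : Memory) (t : ℕ) (i j v : ℤ) : Memory :=
  fun t' i' j' => if t' = t ∧ i' = i ∧ j' = j then v else s t' i' j'

/-- `Run c s k s'`: started in memory `s`, the program `c` halts in memory `s'` with total
cost `k`. `loop e c` repeats `c` as long as the value of `e` is positive. -/
inductive Run : Program → Memory → ℕ → Memory → Prop
  | skip (s : Memory) : Run .skip s 1 s
  | store (s : Memory) (t : ℕ) (i j e : Expr) :
      Run (.store t i j e) s (1 + i.cost s + j.cost s + e.cost s)
        (s.write t (i.eval s) (j.eval s) (e.eval s))
  | seq {c d : Program} {s s' s'' : Memory} {k l : ℕ} :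
      Run c s k s' → Run d s' l s'' → Run (.seq c d) s (k + l) s''
  | ite_pos {e : Expr} {c d : Program} {s s' : Memory} {k : ℕ} :
      0 < e.eval s → Run c s k s' → Run (.ite e c d) s (1 + e.cost s + k) s'
  | ite_neg {e : Expr} {c d : Program} {s s' : Memory} {k : ℕ} :
      ¬ 0 < e.eval s → Run d s k s' → Run (.ite e c d) s (1 + e.cost s + k) s'
  | loop_pos {e : Expr} {c : Program} {s s' s'' : Memory} {k l : ℕ} :
      0 < e.eval s → Run c s k s' → Run (.loop e c) s' l s'' →
        Run (.loop e c) s (1 + e.cost s + k + l) s''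
  | loop_neg {e : Expr} {c : Program} {s : Memory} :
      ¬ 0 < e.eval s → Run (.loop e c) s (1 + e.cost s) s

/-- The table holding an `m × k` integer matrix in the cells `0 ≤ i < m`, `0 ≤ j < k`, and zero
in all other cells. -/
def tableOf {m k : ℕ} (M : Matrix (Fin m) (Fin k) ℤ) : ℤ → ℤ → ℤ := fun i j =>
  if h : (0 ≤ i ∧ i < m) ∧ (0 ≤ j ∧ j < k) then
    M ⟨i.toNat, by omega⟩ ⟨j.toNat, by omega⟩
  else 0

end RAM

/-! ### The problem MaxSUB -/

/-- An instance of MaxSUB: maximize `xᵀ A x` over `x ∈ {0,1}ⁿ` subject to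
`∑ₖ (pₖᵀ x)² ≤ C`. -/
structure MaxSUB where
  n : ℕ
  K : ℕ
  A : Matrix (Fin n) (Fin n) ℚ
  p : Matrix (Fin K) (Fin n) ℚ
  C : ℚ
  K_le : K ≤ n
  offDiag_nonpos : ∀ i j, i ≠ j → A i j ≤ 0
  p_nonneg : ∀ k j, 0 ≤ p k j
  C_pos : 0 < C

namespace MaxSUB

/-- The objective `xᵀ A x`. -/
def objective (I : MaxSUB) (x : Fin I.n → ℚ) : ℚ := dotProduct x (I.A.mulVec x)

/-- `x` is a 0/1-vector. -/
def IsBinary (I : MaxSUB) (x : Fin I.n → ℚ) : Prop := ∀ i, x i = 0 ∨ x i = 1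

/-- `x ∈ {0,1}ⁿ` and `∑ₖ (pₖᵀ x)² ≤ C`. -/
def IsFeasible (I : MaxSUB) (x : Fin I.n → ℚ) : Prop :=
  I.IsBinary x ∧ ∑ k, (dotProduct (I.p k) x) ^ 2 ≤ I.C

/-- The objective is non-negative on `{0,1}ⁿ` once the variables with a negative diagonal
entry (which may be fixed to `0` without loss of generality) are fixed to `0`. -/
def NonnegObjective (I : MaxSUB) : Prop :=
  ∀ x, I.IsBinary x → (∀ i, I.A i i < 0 → x i = 0) → 0 ≤ I.objective x

/-- `opt` is the value of an optimal solution. -/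
def IsOptimalValue (I : MaxSUB) (opt : ℚ) : Prop :=
  IsGreatest {v | ∃ x, I.IsFeasible x ∧ I.objective x = v} opt

/-- `x` is feasible and its value is at least `α` times the optimal value. -/
def IsApproxSolution (I : MaxSUB) (α : ℝ) (x : Fin I.n → ℚ) : Prop :=
  I.IsFeasible x ∧ ∃ opt : ℚ, I.IsOptimalValue opt ∧ α * (opt : ℝ) ≤ (I.objective x : ℝ)

/-- The length of the binary representation of a rational number. -/
def ratLength (q : ℚ) : ℕ := RAM.bitLength q.num + Nat.size q.den

/-- The length of the binary representation of an instance. -/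
def length (I : MaxSUB) : ℕ :=
  Nat.size I.n + Nat.size I.K + ratLength I.C
    + ∑ i, ∑ j, ratLength (I.A i j) + ∑ k, ∑ j, ratLength (I.p k j)

/-- The initial memory on input `(I, ε)`: table `0` holds `n, K`, `C` and `ε`, tables `1, 2`
the numerators and denominators of `A`, and tables `3, 4` those of `p`. All other cells are
zero. -/
def input (I : MaxSUB) (ε : ℚ) : RAM.Memory
  | 0 => RAM.tableOf !![(I.n : ℤ), (I.K : ℤ); I.C.num, (I.C.den : ℤ); ε.num, (ε.den : ℤ)]
  | 1 => RAM.tableOf (I.A.map fun q => q.num)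
  | 2 => RAM.tableOf (I.A.map fun q => (q.den : ℤ))
  | 3 => RAM.tableOf (I.p.map fun q => q.num)
  | 4 => RAM.tableOf (I.p.map fun q => (q.den : ℤ))
  | _ => fun _ _ => 0

/-- The vector read off from the final memory: column `0` of table `5`. -/
def output (I : MaxSUB) (s : RAM.Memory) : Fin I.n → ℚ :=
  fun i => (s 5 ((i : ℕ) : ℤ) 0 : ℚ)

end MaxSUB

/-- `c` is a polynomial-time algorithm which, given an instance of MaxSUB with non-negative
objective and a rational `ε > 0`, computes an `α ε`-approximate solution. The running time is
polynomial in the length of the input and in `1 / ε`. -/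
def IsApproxAlgorithm (c : RAM.Program) (α : ℚ → ℝ) : Prop :=
  ∃ P : Polynomial ℕ, ∀ (I : MaxSUB) (ε : ℚ), I.NonnegObjective → 0 < ε →
    ∃ (t : ℕ) (s : RAM.Memory),
      RAM.Run c (I.input ε) t s ∧
      t ≤ P.eval (I.length + MaxSUB.ratLength ε + ⌈1 / ε⌉₊) ∧
      I.IsApproxSolution (α ε) (I.output s)

/-! ### Quadratic set functions -/

/-! The algorithm solves no relaxation: it is a combination of greedy procedures with ratio 1/14 for
every ε, and φ²/(2e) ≈ 0.0703 lies just below 1/14 ≈ 0.0714 (`golden_ratio_sq_div_le`).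

After clearing denominators, the value of a set is f = `quad a` and its budget use is h = `quad Q`,
with budget c. Non-positive off-diagonal entries make f submodular, but not monotone. The matrix Q
is a Gram matrix with non-negative entries, so h is monotone, and Cauchy–Schwarz bounds its cross
terms (`CrossBound`): the marginal budget uses over S of the elements of a feasible O add up to at
most 2 h(S) + 3c/2. Hence some element has density at least (q - f(S)) / (2 h(S) + 3c/2), where q is
a lower bound for f(S ∪ O). In the continuous picture, (q - f)² (3c + 4h) cannot increase while the
densest element is added; this is the invariant `Progress`. Once h reaches c it forces f ≥ q/3. The
element that exceeds the budget has gain at most m, the bound on singleton values, so greedy ends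
with q ≤ 3 (f(S) + m) (`GreedyBound`).

As f is not monotone, q may be far below f(O). Therefore greedy is run twice, the second time on the
complement of its first solution S₁, giving S₂, and deterministic double greedy extracts X ⊆ S₁ with
f(O ∩ S₁) + f(S₁) ≤ 3 f(X) (`DoubleInv.final`). Submodularity combines these bounds to f(O) ≤ 2
f(S₁) + 3 f(S₂) + 6m + 3 f(X), at most 14 times the best value found (`quad_le_fourteen_mul`).

For the running time, `Exec` is a total-correctness judgement that counts steps and carries a
uniform bound 2^β on all memory cells. Each step costs at most a constant, depending only on the
program text, times β + 2. Since β = 8L + 3 suffices for an input of length at most L (`scaled`) and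
the step count is cubic in L + 1, the cost is polynomial. -/

namespace MaxSUB

open Finset

/-- The quadratic set function of a matrix. -/
def quad (a : ℕ → ℕ → ℤ) (S : Finset ℕ) : ℤ := ∑ i ∈ S, ∑ j ∈ S, a i j

/-- The marginal value of an element `e ∉ S`. -/
def marg (a : ℕ → ℕ → ℤ) (e : ℕ) (S : Finset ℕ) : ℤ := a e e + ∑ j ∈ S, (a e j + a j e)

variable {a Q : ℕ → ℕ → ℤ}

@[simp] theorem quad_empty : quad a ∅ = 0 := by simp [quad]

@[simp] theorem marg_empty (e : ℕ) : marg a e ∅ = a e e := by simp [marg]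

theorem quad_singleton (e : ℕ) : quad a {e} = a e e := by simp [quad]

theorem quad_insert {e : ℕ} {S : Finset ℕ} (he : e ∉ S) :
    quad a (insert e S) = quad a S + marg a e S := by
  simp only [quad, marg, sum_insert he, sum_add_distrib]
  ring

/-- The element `e` may lie in `S` or equal `i`. A program can thus update the whole vector of
marginals by one formula, without case distinctions. -/
theorem marg_insert (e : ℕ) {i : ℕ} {S : Finset ℕ} (hi : i ∉ S) :
    marg a e (insert i S) = marg a e S + (a e i + a i e) := by
  simp only [marg, sum_insert hi]
  ring

/-- For `e ∈ S` the sum in `marg a e S` contains `2 * a e e` on top of the true marginal over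
`S.erase e`; the correction removes it. -/
theorem quad_erase {e : ℕ} {S : Finset ℕ} (he : e ∈ S) :
    quad a (S.erase e) = quad a S - (marg a e S - 2 * a e e) := by
  have h1 := quad_insert (a := a) (notMem_erase e S)
  have h2 := marg_insert (a := a) e (notMem_erase e S)
  rw [insert_erase he] at h1 h2
  linarith

theorem marg_erase (e : ℕ) {i : ℕ} {S : Finset ℕ} (hi : i ∈ S) :
    marg a e (S.erase i) = marg a e S - (a e i + a i e) := by
  have h2 := marg_insert (a := a) e (notMem_erase i S)
  rw [insert_erase hi] at h2
  linarith

theorem quad_union_of_disjoint {S T : Finset ℕ} (h : Disjoint S T) :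
    quad a (S ∪ T) = quad a S + quad a T + ∑ i ∈ S, ∑ j ∈ T, (a i j + a j i) := by
  have hc : ∑ i ∈ S, ∑ j ∈ T, a j i = ∑ i ∈ T, ∑ j ∈ S, a i j := sum_comm
  simp only [quad, sum_union h, sum_add_distrib, hc]
  ring

theorem marg_anti (ha : ∀ i j, i ≠ j → a i j ≤ 0) {e : ℕ} {S T : Finset ℕ} (h : T ⊆ S)
    (he : e ∉ S) : marg a e S ≤ marg a e T := by
  simp only [marg, ← sum_sdiff h]
  have : ∑ j ∈ S \ T, (a e j + a j e) ≤ 0 := by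
    refine sum_nonpos fun j hj => ?_
    have hj : e ≠ j := fun h => he (h ▸ (mem_sdiff.1 hj).1)
    linarith [ha e j hj, ha j e hj.symm]
  linarith

/-- Submodularity: adding `T \ S` to the larger set `S` instead of `S ∩ T` only brings in further
cross terms, all non-positive. -/
theorem quad_union_add_quad_inter_le (ha : ∀ i j, i ≠ j → a i j ≤ 0) (S T : Finset ℕ) :
    quad a (S ∪ T) + quad a (S ∩ T) ≤ quad a S + quad a T := by
  have h1 := quad_union_of_disjoint (a := a) (disjoint_sdiff (s := S) (t := T))
  have h2 := quad_union_of_disjoint (a := a)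
    ((disjoint_sdiff (s := S) (t := T)).mono_left (inter_subset_left (s₂ := T)))
  rw [union_sdiff_self_eq_union] at h1
  have h3 : S ∩ T ∪ T \ S = T := by
    ext x; simp only [mem_union, mem_inter, mem_sdiff]; tauto
  rw [h3] at h2
  have h4 : ∑ i ∈ S, ∑ j ∈ T \ S, (a i j + a j i) ≤
      ∑ i ∈ S ∩ T, ∑ j ∈ T \ S, (a i j + a j i) := by
    rw [← sum_sdiff (inter_subset_left (s₁ := S) (s₂ := T))]
    have : ∑ i ∈ S \ (S ∩ T), ∑ j ∈ T \ S, (a i j + a j i) ≤ 0 := by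
      refine sum_nonpos fun i hi => sum_nonpos fun j hj => ?_
      have hij : i ≠ j := by
        rintro rfl
        exact (mem_sdiff.1 hj).2 (mem_sdiff.1 hi).1
      linarith [ha i j hij, ha j i hij.symm]
    linarith
  linarith

theorem quad_union_le (ha : ∀ i j, i ≠ j → a i j ≤ 0) (S T : Finset ℕ) :
    quad a (S ∪ T) ≤ quad a S + ∑ e ∈ T \ S, marg a e S := by
  induction T using Finset.induction_on with
  | empty => simp
  | insert e T he ih =>
    by_cases heS : e ∈ S
    · rw [union_insert, insert_eq_of_mem (mem_union_left _ heS), insert_sdiff_of_mem _ heS]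
      exact ih
    · have heST : e ∉ S ∪ T := by simp [heS, he]
      rw [union_insert, quad_insert heST, insert_sdiff_of_notMem _ heS,
        sum_insert (fun h => he (mem_sdiff.1 h).1)]
      linarith [marg_anti ha subset_union_left heST]

theorem quad_mono (hQ : ∀ i j, 0 ≤ Q i j) {S T : Finset ℕ} (h : S ⊆ T) :
    quad Q S ≤ quad Q T :=
  (sum_le_sum fun i _ => sum_le_sum_of_subset_of_nonneg h fun j _ _ => hQ i j).trans
    (sum_le_sum_of_subset_of_nonneg h fun i _ _ => sum_nonneg fun j _ => hQ i j)

theorem marg_nonneg (hQ : ∀ i j, 0 ≤ Q i j) (e : ℕ) (S : Finset ℕ) : 0 ≤ marg Q e S :=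
  add_nonneg (hQ e e) (sum_nonneg fun j _ => add_nonneg (hQ e j) (hQ j e))

theorem quad_nonneg (hQ : ∀ i j, 0 ≤ Q i j) (S : Finset ℕ) : 0 ≤ quad Q S :=
  sum_nonneg fun i _ => sum_nonneg fun j _ => hQ i j

theorem abs_quad_le {n : ℕ} {R : ℤ} (hR : ∀ i j, |a i j| ≤ R) {S : Finset ℕ}
    (hS : S ⊆ range n) : |quad a S| ≤ n ^ 2 * R := by
  have hR0 : 0 ≤ R := (abs_nonneg _).trans (hR 0 0)
  have hc : (S.card : ℤ) ≤ n := by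
    have := card_le_card hS
    rw [card_range] at this
    exact_mod_cast this
  calc |quad a S| ≤ ∑ i ∈ S, ∑ j ∈ S, |a i j| :=
        (abs_sum_le_sum_abs _ _).trans (sum_le_sum fun i _ => abs_sum_le_sum_abs _ _)
    _ ≤ ∑ i ∈ S, ∑ j ∈ S, R := sum_le_sum fun i _ => sum_le_sum fun j _ => hR i j
    _ = S.card * S.card * R := by simp [mul_assoc]
    _ ≤ n * n * R := by gcongr
    _ = n ^ 2 * R := by ring

theorem abs_marg_le {n : ℕ} {R : ℤ} (hR : ∀ i j, |a i j| ≤ R) (e : ℕ) {S : Finset ℕ}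
    (hS : S ⊆ range n) : |marg a e S| ≤ (2 * n + 1) * R := by
  have hR0 : 0 ≤ R := (abs_nonneg _).trans (hR 0 0)
  have hc : (S.card : ℤ) ≤ n := by
    have := card_le_card hS
    rw [card_range] at this
    exact_mod_cast this
  have h2 : |∑ j ∈ S, (a e j + a j e)| ≤ S.card * (2 * R) :=
    calc |∑ j ∈ S, (a e j + a j e)| ≤ ∑ j ∈ S, |a e j + a j e| := abs_sum_le_sum_abs _ _
      _ ≤ ∑ j ∈ S, (2 * R) := sum_le_sum fun j _ =>
          (abs_add_le _ _).trans (by linarith [hR e j, hR j e])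
      _ = _ := by simp
  calc |marg a e S| ≤ |a e e| + |∑ j ∈ S, (a e j + a j e)| := abs_add_le _ _
    _ ≤ R + S.card * (2 * R) := add_le_add (hR e e) h2
    _ ≤ R + n * (2 * R) := by gcongr
    _ = _ := by ring

/-! ### Greedy by density -/

/-- The Cauchy–Schwarz type bound on cross terms that holds for positive semidefinite `Q`. -/
def CrossBound (Q : ℕ → ℕ → ℤ) : Prop :=
  ∀ S T : Finset ℕ, 2 * ∑ i ∈ T, ∑ j ∈ S, (Q i j + Q j i) ≤ 4 * quad Q S + quad Q T

/-- The diagonal entries over `T` contribute at most `quad Q T`, and the cross terms with `S` are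
controlled by `CrossBound`. This replaces submodularity, which fails for the budget. -/
theorem sum_marg_le (hQ : ∀ i j, 0 ≤ Q i j) (hX : CrossBound Q) (S T : Finset ℕ) :
    2 * ∑ e ∈ T \ S, marg Q e S ≤ 4 * quad Q S + 3 * quad Q T := by
  have h1 : ∑ e ∈ T \ S, marg Q e S ≤ ∑ e ∈ T, marg Q e S :=
    sum_le_sum_of_subset_of_nonneg sdiff_subset fun e _ _ => marg_nonneg hQ e S
  have h2 : ∑ e ∈ T, Q e e ≤ quad Q T := sum_le_sum fun e he =>
    single_le_sum (f := fun j => Q e j) (fun j _ => hQ e j) he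
  have h3 : ∑ e ∈ T, marg Q e S = ∑ e ∈ T, Q e e + ∑ i ∈ T, ∑ j ∈ S, (Q i j + Q j i) := by
    simp only [marg, sum_add_distrib]
  linarith [hX S T]

/-- The inequality between the value `f` and the budget use `h` maintained by the greedy
algorithm with respect to the reference value `q`. -/
def Progress (c q f h : ℤ) : Prop :=
  q ≤ f ∨ (q - f) ^ 2 * (3 * c + 4 * h) ≤ 3 * c * q ^ 2

/-- Discrete form of the differential inequality df/dh ≥ 2 (q - f) / (4h + 3c), under which (q - f)²
(3c + 4h) does not increase. Overshooting `q` is the other alternative of `Progress`. -/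
theorem Progress.step {c q f h F H : ℤ} (hc : 0 < c) (hh : 0 ≤ h) (hF : 0 ≤ F) (hH : 0 ≤ H)
    (hp : Progress c q f h) (hd : 2 * (H * (q - f)) ≤ F * (4 * h + 3 * c)) :
    Progress c q (f + F) (h + H) := by
  by_cases hle : q ≤ f + F
  · exact Or.inl hle
  right
  push Not at hle
  rcases hp with hp | hp
  · linarith
  refine le_trans ?_ hp
  have hN : (0 : ℤ) < 3 * c + 4 * h := by linarith
  suffices hs : ((q - (f + F)) ^ 2 * (3 * c + 4 * (h + H)) : ℚ) ≤
      (q - f) ^ 2 * (3 * c + 4 * h) by exact_mod_cast hs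
  have hN' : (0 : ℚ) < 3 * c + 4 * h := by exact_mod_cast hN
  obtain ⟨N, hNdef⟩ : ∃ N : ℚ, N = 3 * c + 4 * h := ⟨_, rfl⟩
  obtain ⟨z, hz⟩ : ∃ z : ℚ, z = q - f := ⟨_, rfl⟩
  -- With this `x`, the gap shrinks at least by the factor 1 - x and `N` grows exactly by 1 + 2x, so
  -- the claim becomes (1 - x)² (1 + 2x) ≤ 1 for 0 ≤ x ≤ 1.
  obtain ⟨x, hx⟩ : ∃ x : ℚ, x = 2 * H / N := ⟨_, rfl⟩
  rw [← hNdef] at hN'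
  have hxN : x * N = 2 * H := by rw [hx]; field_simp
  have hH' : (0 : ℚ) ≤ H := by exact_mod_cast hH
  have hx0 : 0 ≤ x := by rw [hx]; positivity
  have hle' : (F : ℚ) < z := by
    have : (f + F : ℚ) < q := by exact_mod_cast hle
    rw [hz]; linarith
  have hF' : (0 : ℚ) ≤ F := by exact_mod_cast hF
  have hd' : (2 * (H * z) : ℚ) ≤ F * N := by
    rw [hz, hNdef]
    have : (2 * (H * (q - f)) : ℚ) ≤ F * (4 * h + 3 * c) := by exact_mod_cast hd
    linarith
  have hy : x * z ≤ F := by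
    have : (x * z) * N ≤ F * N := by
      calc x * z * N = x * N * z := by ring
        _ ≤ F * N := by rw [hxN]; linarith
    exact le_of_mul_le_mul_right this hN'
  have hx1 : x ≤ 1 := by nlinarith
  have hsq : (z - F) ^ 2 ≤ (z - x * z) ^ 2 := by
    apply pow_le_pow_left₀ <;> linarith
  have hNH : (3 * c + 4 * (h + H) : ℚ) = N * (1 + 2 * x) := by
    rw [mul_add, mul_add, mul_one]
    linarith
  have e1 : (q - (f + F) : ℚ) = z - F := by rw [hz]; ring
  rw [e1, hNH, ← hNdef, ← hz]
  have hpoly : (1 - x) ^ 2 * (1 + 2 * x) ≤ 1 := by nlinarith [mul_nonneg hx0 hx0]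
  calc (z - F) ^ 2 * (N * (1 + 2 * x)) ≤ (z - x * z) ^ 2 * (N * (1 + 2 * x)) := by gcongr
    _ = z ^ 2 * N * ((1 - x) ^ 2 * (1 + 2 * x)) := by ring
    _ ≤ z ^ 2 * N * 1 := by gcongr
    _ = z ^ 2 * N := by ring

/-- At h ≥ c the second alternative gives (q - f)² ≤ (3/7) q², and 3/7 < (2/3)², so the gap is at
most two thirds of `q`. -/
theorem Progress.le_of_full {c q f h : ℤ} (hc : 0 < c) (hq : 0 ≤ q) (hch : c ≤ h)
    (hp : Progress c q f h) : q ≤ 3 * f ∨ q ≤ f := by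
  rcases hp with hp | hp
  · exact Or.inr hp
  · left
    by_contra hlt
    push Not at hlt
    have h1 : (q - f) ^ 2 * (7 * c) ≤ 3 * c * q ^ 2 :=
      le_trans (mul_le_mul_of_nonneg_left (by linarith) (sq_nonneg _)) hp
    have h2 : 7 * (q - f) ^ 2 ≤ 3 * q ^ 2 := by nlinarith
    have h3 : (2 * q) ^ 2 < (3 * (q - f)) ^ 2 := by
      apply pow_lt_pow_left₀ <;> linarith
    nlinarith

/-- Every reference solution inside `G` yields progress. -/
def GreedyInv (a Q : ℕ → ℕ → ℤ) (c : ℤ) (G S : Finset ℕ) : Prop :=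
  ∀ O ⊆ G, quad Q O ≤ c → ∀ q, 0 ≤ q → (∀ S' ⊆ S, q ≤ quad a (S' ∪ O)) →
    Progress c q (quad a S) (quad Q S)

/-- The guarantee of the greedy solution `S`, combined with the value `m` of a best singleton. -/
def GreedyBound (a Q : ℕ → ℕ → ℤ) (c m : ℤ) (G S : Finset ℕ) : Prop :=
  ∀ O ⊆ G, quad Q O ≤ c → ∀ q, 0 ≤ q → (∀ S' ⊆ S, q ≤ quad a (S' ∪ O)) →
    q ≤ 3 * (quad a S + m)

theorem greedyInv_empty (c : ℤ) (G : Finset ℕ) : GreedyInv a Q c G ∅ := by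
  intro O _ _ q _ _
  right
  simp only [quad_empty]
  apply le_of_eq
  ring

theorem GreedyBound.insert_elem {c m : ℤ} {G S : Finset ℕ} {e : ℕ} (h : GreedyBound a Q c m G S)
    (he : e ∉ S) (hF : 0 ≤ marg a e S) : GreedyBound a Q c m G (insert e S) := by
  intro O hO hQO q hq hS
  have := h O hO hQO q hq fun S' hS' => hS S' (hS'.trans (subset_insert _ _))
  rw [quad_insert he]
  linarith

/-- Averaging: F / H is at least the density of `O \ S` as a whole, whose gains add up to at least q
- f(S) by submodularity. `F` and `H` need not come from a step that is carried out, so the lemma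
also covers an element that exceeds the budget. -/
theorem progress_of_densest (ha : ∀ i j, i ≠ j → a i j ≤ 0) (hQ : ∀ i j, 0 ≤ Q i j)
    (hX : CrossBound Q) {c : ℤ} (hc : 0 < c) {S O : Finset ℕ} {q F H : ℤ} (hO : quad Q O ≤ c)
    (hF : 0 ≤ F) (hH : 0 ≤ H) (hq : q ≤ quad a (S ∪ O))
    (hbest : ∀ e ∈ O \ S, H * marg a e S ≤ marg Q e S * F)
    (hp : Progress c q (quad a S) (quad Q S)) :
    Progress c q (quad a S + F) (quad Q S + H) := by
  refine hp.step hc (quad_nonneg hQ S) hF hH ?_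
  have h1 := quad_union_le ha S O
  have h2 := sum_marg_le hQ hX S O
  have h3 : H * ∑ e ∈ O \ S, marg a e S ≤ (∑ e ∈ O \ S, marg Q e S) * F := by
    rw [mul_sum, sum_mul]
    exact sum_le_sum hbest
  calc 2 * (H * (q - quad a S)) ≤ 2 * (H * ∑ e ∈ O \ S, marg a e S) := by
        gcongr; linarith
    _ ≤ (2 * ∑ e ∈ O \ S, marg Q e S) * F := by linarith
    _ ≤ (4 * quad Q S + 3 * c) * F := by gcongr; linarith
    _ = F * (4 * quad Q S + 3 * c) := by ring

theorem GreedyInv.insert_elem (ha : ∀ i j, i ≠ j → a i j ≤ 0) (hQ : ∀ i j, 0 ≤ Q i j)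
    (hX : CrossBound Q) {c : ℤ} (hc : 0 < c) {G S : Finset ℕ} {i : ℕ} (h : GreedyInv a Q c G S)
    (hi : i ∉ S) (hF : 0 ≤ marg a i S)
    (hbest : ∀ e ∈ G \ S, marg Q i S * marg a e S ≤ marg Q e S * marg a i S) :
    GreedyInv a Q c G (insert i S) := by
  intro O hO hQO q hq hS
  rw [quad_insert hi, quad_insert hi]
  exact progress_of_densest ha hQ hX hc hQO hF (marg_nonneg hQ i S) (hS S (subset_insert _ _))
    (fun e he => hbest e (sdiff_subset_sdiff hO subset_rfl he))
    (h O hO hQO q hq fun S' hS' => hS S' (hS'.trans (subset_insert _ _)))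

/-- Pretend that the densest element is added although it does not fit. The budget is then full, so
q ≤ 3 (f(S) + F), and by submodularity the fictitious gain is at most `a i i ≤ m`. -/
theorem GreedyInv.bound_of_not_fit (ha : ∀ i j, i ≠ j → a i j ≤ 0) (hQ : ∀ i j, 0 ≤ Q i j)
    (hX : CrossBound Q) {c m : ℤ} (hc : 0 < c) {G S : Finset ℕ} {i : ℕ}
    (h : GreedyInv a Q c G S) (hi : i ∉ S) (hm : a i i ≤ m) (hS0 : 0 ≤ quad a S)
    (hF : 0 ≤ marg a i S)
    (hbest : ∀ e ∈ G \ S, marg Q i S * marg a e S ≤ marg Q e S * marg a i S)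
    (hfull : c < quad Q S + marg Q i S) : GreedyBound a Q c m G S := by
  intro O hO hQO q hq hS
  have hp := progress_of_densest ha hQ hX hc hQO hF (marg_nonneg hQ i S) (hS S subset_rfl)
    (fun e he => hbest e (sdiff_subset_sdiff hO subset_rfl he)) (h O hO hQO q hq hS)
  have h1 := marg_anti ha (empty_subset S) hi
  rw [marg_empty] at h1
  rcases hp.le_of_full hc hq hfull.le with h2 | h2 <;> linarith

theorem greedyBound_of_no_gain (ha : ∀ i j, i ≠ j → a i j ≤ 0) {c m : ℤ} {G S : Finset ℕ}
    (hm : 0 ≤ m) (hS0 : 0 ≤ quad a S) (h : ∀ e ∈ G \ S, marg a e S ≤ 0) :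
    GreedyBound a Q c m G S := by
  intro O hO hQO q hq hS
  have h1 := hS S subset_rfl
  have h2 := quad_union_le ha S O
  have h3 : ∑ e ∈ O \ S, marg a e S ≤ 0 :=
    sum_nonpos fun e he => h e (sdiff_subset_sdiff hO subset_rfl he)
  linarith

/-! ### The deterministic double greedy algorithm -/

/-- The invariant of the double greedy algorithm on the ground set `S₁`, for the nested pair
`X ⊆ Y`. -/
def DoubleInv (a : ℕ → ℕ → ℤ) (S₁ X Y : Finset ℕ) : Prop :=
  ∀ O ⊆ S₁, quad a O - quad a ((O ∪ X) ∩ Y) ≤ quad a X + quad a Y - quad a S₁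

theorem doubleInv_init (S₁ : Finset ℕ) : DoubleInv a S₁ ∅ S₁ := by
  intro O hO
  rw [union_empty, inter_eq_left.2 hO]
  simp

/-- If `i ∈ O`, the hybrid set does not change, and the gain over `X` is non-negative because it
dominates the marginal over `Y.erase i`. If `i ∉ O`, the hybrid set loses at most the negative of
that marginal, which `hg` bounds by the gain over `X`. -/
theorem DoubleInv.insert_elem (ha : ∀ i j, i ≠ j → a i j ≤ 0) {S₁ X Y : Finset ℕ} {i : ℕ}
    (h : DoubleInv a S₁ X Y) (hXY : X ⊆ Y) (hi : i ∉ X) (hiY : i ∈ Y)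
    (hg : 0 ≤ marg a i X + (marg a i Y - 2 * a i i)) : DoubleInv a S₁ (insert i X) Y := by
  intro O hO
  have hY : marg a i (Y.erase i) = marg a i Y - 2 * a i i := by rw [marg_erase i hiY]; ring
  rw [← hY] at hg
  have h0 := h O hO
  rw [quad_insert hi]
  by_cases hiO : i ∈ O
  · have h1 : O ∪ insert i X = O ∪ X := by rw [union_insert, insert_eq_of_mem (by simp [hiO])]
    have h2 := marg_anti ha (T := X) (S := Y.erase i) (e := i)
      (subset_erase.2 ⟨hXY, hi⟩) (notMem_erase _ _)
    rw [h1]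
    linarith
  · have h1 : (O ∪ insert i X) ∩ Y = insert i ((O ∪ X) ∩ Y) := by
      rw [union_insert, insert_inter_of_mem hiY]
    have hni : i ∉ (O ∪ X) ∩ Y := by simp [hiO, hi]
    have h2 := marg_anti ha (T := (O ∪ X) ∩ Y) (S := Y.erase i) (e := i)
      (subset_erase.2 ⟨inter_subset_right, hni⟩) (notMem_erase _ _)
    rw [h1, quad_insert hni]
    linarith

theorem DoubleInv.erase_elem (ha : ∀ i j, i ≠ j → a i j ≤ 0) {S₁ X Y : Finset ℕ} {i : ℕ}
    (h : DoubleInv a S₁ X Y) (hXY : X ⊆ Y) (hi : i ∉ X) (hiY : i ∈ Y)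
    (hg : marg a i X + (marg a i Y - 2 * a i i) ≤ 0) : DoubleInv a S₁ X (Y.erase i) := by
  intro O hO
  have hY : marg a i (Y.erase i) = marg a i Y - 2 * a i i := by rw [marg_erase i hiY]; ring
  have h0 := h O hO
  rw [quad_erase hiY, ← hY]
  rw [← hY] at hg
  have h1 : (O ∪ X) ∩ Y.erase i = ((O ∪ X) ∩ Y).erase i := by rw [inter_erase]
  by_cases hiO : i ∈ O
  · have hmem : i ∈ (O ∪ X) ∩ Y := by simp [hiO, hiY]
    have h2 := marg_anti ha (T := X) (S := ((O ∪ X) ∩ Y).erase i) (e := i)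
      (subset_erase.2 ⟨subset_inter subset_union_right hXY, hi⟩) (notMem_erase _ _)
    have h3 : quad a ((O ∪ X) ∩ Y) = quad a (((O ∪ X) ∩ Y).erase i) +
        marg a i (((O ∪ X) ∩ Y).erase i) := by
      rw [← quad_insert (notMem_erase _ _), insert_erase hmem]
    rw [h1]
    linarith
  · have hni : i ∉ (O ∪ X) ∩ Y := by simp [hiO, hi]
    have h2 := marg_anti ha (T := X) (S := Y.erase i) (e := i)
      (subset_erase.2 ⟨hXY, hi⟩) (notMem_erase _ _)
    rw [h1, erase_eq_of_notMem hni]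
    linarith

/-- Keeping the starting value `quad a S₁` on the left is stronger than the usual 1/3 guarantee; the
surplus lowers the final constant from 15 to 14. -/
theorem DoubleInv.final {S₁ X O : Finset ℕ} (h : DoubleInv a S₁ X X) (hO : O ⊆ S₁) :
    quad a O + quad a S₁ ≤ 3 * quad a X := by
  have := h O hO
  rw [inter_eq_right.2 subset_union_right] at this
  linarith

/-! ### Combination of the three solutions -/

theorem exists_forall_le_quad_union (a : ℕ → ℕ → ℤ) (S O : Finset ℕ) :
    ∃ T ⊆ S, ∀ S' ⊆ S, quad a (T ∪ O) ≤ quad a (S' ∪ O) := by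
  obtain ⟨T, hT, h⟩ := exists_min_image S.powerset (fun T => quad a (T ∪ O)) ⟨∅, by simp⟩
  exact ⟨T, mem_powerset.1 hT, fun S' hS' => h S' (mem_powerset.2 hS')⟩

/-- Let T₁ ⊆ S₁ and T₂ ⊆ S₂ minimise f(T₁ ∪ O) and f(T₂ ∪ (O \ S₁)); these minima are the reference
values of the two greedy runs. The two sets meet exactly in O \ S₁ and their union has non-negative
value, so f(O \ S₁) is at most the sum of the minima. The rest, f(O ∩ S₁), is paid for by `X`. -/
theorem quad_le_fourteen_mul (ha : ∀ i j, i ≠ j → a i j ≤ 0) (hQ : ∀ i j, 0 ≤ Q i j)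
    {c m b : ℤ} {V G S₁ S₂ X O : Finset ℕ} (hV : ∀ S ⊆ V, 0 ≤ quad a S)
    (hO : O ⊆ G) (hOV : O ⊆ V) (hQO : quad Q O ≤ c)
    (h₁ : GreedyBound a Q c m G S₁) (h₂ : GreedyBound a Q c m (G \ S₁) S₂)
    (hS₁ : S₁ ⊆ V) (hS₂ : S₂ ⊆ V) (hd : Disjoint S₁ S₂)
    (hX : DoubleInv a S₁ X X) (hm : m ≤ b) (hb₁ : quad a S₁ ≤ b) (hb₂ : quad a S₂ ≤ b)
    (hbX : quad a X ≤ b) : quad a O ≤ 14 * b := by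
  obtain ⟨T₁, hT₁, hmin₁⟩ := exists_forall_le_quad_union a S₁ O
  obtain ⟨T₂, hT₂, hmin₂⟩ := exists_forall_le_quad_union a S₂ (O \ S₁)
  have hO' : O \ S₁ ⊆ V := sdiff_subset.trans hOV
  have e1 := h₁ O hO hQO _ (hV _ (union_subset (hT₁.trans hS₁) hOV)) hmin₁
  have e2 := h₂ (O \ S₁) (sdiff_subset_sdiff hO subset_rfl)
    ((quad_mono hQ sdiff_subset).trans hQO) _ (hV _ (union_subset (hT₂.trans hS₂) hO')) hmin₂
  have e3 := hX.final (O := O ∩ S₁) inter_subset_right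
  have e4 := quad_union_add_quad_inter_le ha (T₁ ∪ O) (T₂ ∪ O \ S₁)
  have e5 := hV (T₁ ∪ O ∪ (T₂ ∪ O \ S₁)) (union_subset (union_subset (hT₁.trans hS₁) hOV)
    (union_subset (hT₂.trans hS₂) hO'))
  have e6 : (T₁ ∪ O) ∩ (T₂ ∪ O \ S₁) = O \ S₁ := by
    ext x
    have hx : x ∈ T₂ → x ∉ S₁ := fun h1 h2 => (Finset.disjoint_left.1 hd) h2 (hT₂ h1)
    have hx' := @hT₁ x
    simp only [mem_inter, mem_union, mem_sdiff]
    tauto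
  have e7 := quad_union_add_quad_inter_le ha (O \ S₁) (O ∩ S₁)
  rw [sdiff_union_inter, disjoint_iff_inter_eq_empty.1 (disjoint_sdiff_inter O S₁), quad_empty] at e7
  rw [e6] at e4
  linarith

/-- A marginal never exceeds the diagonal entry, so dropping all elements with a negative one does
not lower the value. -/
theorem quad_le_quad_filter (ha : ∀ i j, i ≠ j → a i j ≤ 0) (O : Finset ℕ) :
    quad a O ≤ quad a (O.filter fun i => 0 ≤ a i i) := by
  have h1 := quad_union_le ha (O.filter fun i => 0 ≤ a i i) O
  rw [union_eq_right.2 (filter_subset _ _)] at h1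
  have h2 : ∑ e ∈ O \ O.filter (fun i => 0 ≤ a i i),
      marg a e (O.filter fun i => 0 ≤ a i i) ≤ 0 := by
    refine sum_nonpos fun e he => ?_
    obtain ⟨he1, he2⟩ := mem_sdiff.1 he
    have h3 := marg_anti ha (empty_subset _) he2
    rw [marg_empty] at h3
    have : ¬ 0 ≤ a e e := fun h => he2 (mem_filter.2 ⟨he1, h⟩)
    linarith
  linarith

end MaxSUB

/-! ### Total correctness and cost of programs -/

namespace RAM

/-- All cells are smaller than `2 ^ β` in absolute value. -/
def Bounded (β : ℕ) (s : Memory) : Prop := ∀ t i j, |s t i j| < 2 ^ β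

theorem bitLength_le_iff {z : ℤ} {β : ℕ} : bitLength z ≤ β ↔ |z| < 2 ^ β := by
  rw [bitLength, Nat.size_le, Int.abs_eq_natAbs]
  exact_mod_cast Iff.rfl

theorem bitLength_add (a b : ℤ) : bitLength (a + b) ≤ bitLength a + bitLength b + 1 := by
  rw [bitLength_le_iff]
  have ha := bitLength_le_iff.1 (le_refl (bitLength a))
  have hb := bitLength_le_iff.1 (le_refl (bitLength b))
  have h1 : (2 : ℤ) ^ bitLength a ≤ 2 ^ (bitLength a + bitLength b) :=
    pow_le_pow_right₀ (by norm_num) (by omega)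
  have h2 : (2 : ℤ) ^ bitLength b ≤ 2 ^ (bitLength a + bitLength b) :=
    pow_le_pow_right₀ (by norm_num) (by omega)
  have := abs_add_le a b
  rw [pow_succ]
  linarith

theorem bitLength_neg (a : ℤ) : bitLength (-a) = bitLength a := by simp [bitLength]

theorem bitLength_sub (a b : ℤ) : bitLength (a - b) ≤ bitLength a + bitLength b + 1 := by
  rw [sub_eq_add_neg, ← bitLength_neg b]
  exact bitLength_add _ _

theorem bitLength_mul (a b : ℤ) : bitLength (a * b) ≤ bitLength a + bitLength b := by
  rw [bitLength_le_iff, abs_mul, pow_add]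
  exact mul_lt_mul'' (bitLength_le_iff.1 le_rfl) (bitLength_le_iff.1 le_rfl) (abs_nonneg _)
    (abs_nonneg _)

theorem bitLength_div (a b : ℤ) : bitLength (a / b) ≤ bitLength a :=
  Nat.size_le_size (Int.natAbs_ediv_le_natAbs a b)

/-- The size of an expression, with constants counted by their bit length. -/
def Expr.weight : Expr → ℕ
  | .const z => bitLength z + 1
  | .load _ i j => i.weight + j.weight + 1
  | .add a b => a.weight + b.weight + 1
  | .sub a b => a.weight + b.weight + 1
  | .mul a b => a.weight + b.weight + 1
  | .div a b => a.weight + b.weight + 1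

theorem Expr.bitLength_eval_le {β : ℕ} {s : Memory} (hs : Bounded β s) (e : Expr) :
    bitLength (e.eval s) ≤ e.weight * (β + 1) := by
  induction e with
  | const z => simp only [eval, weight]; nlinarith
  | load t i j =>
    have := bitLength_le_iff.2 (hs t (i.eval s) (j.eval s))
    simp only [eval, weight]
    nlinarith
  | add a b iha ihb =>
    have := bitLength_add (a.eval s) (b.eval s)
    simp only [eval, weight]
    nlinarith
  | sub a b iha ihb =>
    have := bitLength_sub (a.eval s) (b.eval s)
    simp only [eval, weight]
    nlinarith
  | mul a b iha ihb =>
    have := bitLength_mul (a.eval s) (b.eval s)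
    simp only [eval, weight]
    nlinarith
  | div a b iha ihb =>
    have := bitLength_div (a.eval s) (b.eval s)
    simp only [eval, weight]
    nlinarith

/-- Weights enter squared because each node pays for the length of its own value, which is linear in
the weight of its subtree; the surplus of (u + v + 1)² over u² + v² covers this. -/
theorem cost_node_le {u v x y z β : ℕ} (hx : x ≤ u ^ 2 * (β + 2)) (hy : y ≤ v ^ 2 * (β + 2))
    (hz : z ≤ (u + v + 1) * (β + 1)) : x + y + (1 + z) ≤ (u + v + 1) ^ 2 * (β + 2) := by
  have h : (u + v + 1) ^ 2 * (β + 2) = u ^ 2 * (β + 2) + v ^ 2 * (β + 2) +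
      (u + v + 1) * (β + 1) + (u + v + 1) + (2 * u * v + u + v) * (β + 2) := by ring
  rw [h]
  have : 0 ≤ (2 * u * v + u + v) * (β + 2) := Nat.zero_le _
  omega

theorem Expr.cost_le {β : ℕ} {s : Memory} (hs : Bounded β s) (e : Expr) :
    e.cost s ≤ e.weight ^ 2 * (β + 2) := by
  induction e with
  | const z => simp only [cost, weight]; nlinarith
  | load t i j iha ihb =>
    exact cost_node_le iha ihb (Expr.bitLength_eval_le hs (.load t i j))
  | add a b iha ihb => exact cost_node_le iha ihb (Expr.bitLength_eval_le hs (.add a b))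
  | sub a b iha ihb => exact cost_node_le iha ihb (Expr.bitLength_eval_le hs (.sub a b))
  | mul a b iha ihb => exact cost_node_le iha ihb (Expr.bitLength_eval_le hs (.mul a b))
  | div a b iha ihb => exact cost_node_le iha ihb (Expr.bitLength_eval_le hs (.div a b))

namespace Program

/-- An upper bound, up to a factor `β + 2`, for the cost of a single step of a program. -/
def weight : Program → ℕ
  | .skip => 1
  | .store _ i j e => 1 + i.weight ^ 2 + j.weight ^ 2 + e.weight ^ 2
  | .seq c d => c.weight + d.weight
  | .ite e c d => 1 + e.weight ^ 2 + c.weight + d.weight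
  | .loop e c => 1 + e.weight ^ 2 + c.weight

/-- The program text contains no store into table `t`. -/
def avoids (t : ℕ) : Program → Bool
  | .skip => true
  | .store t' _ _ _ => t != t'
  | .seq c d => c.avoids t && d.avoids t
  | .ite _ c d => c.avoids t && d.avoids t
  | .loop _ c => c.avoids t

end Program

theorem Memory.write_of_ne (s : Memory) {t t' : ℕ} (h : t' ≠ t) (i j v : ℤ) :
    s.write t i j v t' = s t' := by
  funext i' j'
  simp [Memory.write, h]

theorem Memory.write_same (s : Memory) (t : ℕ) (i j v i' j' : ℤ) :
    s.write t i j v t i' j' = if i' = i ∧ j' = j then v else s t i' j' := by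
  simp [Memory.write]

/-- A frame rule. Table numbers are literals of the program text, so the side condition is decidable
and for concrete programs usually closes by `rfl`. -/
theorem Run.eq_of_avoids {c : Program} {s s' : Memory} {k : ℕ} (h : Run c s k s') {t : ℕ}
    (ht : c.avoids t = true) : s' t = s t := by
  induction h with
  | skip => rfl
  | store s t' i j e =>
    apply Memory.write_of_ne
    simpa [Program.avoids] using ht
  | seq _ _ ih1 ih2 =>
    simp only [Program.avoids, Bool.and_eq_true] at ht
    rw [ih2 ht.2, ih1 ht.1]
  | ite_pos _ _ ih =>
    simp only [Program.avoids, Bool.and_eq_true] at ht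
    exact ih ht.1
  | ite_neg _ _ ih =>
    simp only [Program.avoids, Bool.and_eq_true] at ht
    exact ih ht.2
  | loop_pos _ _ _ ih1 ih2 =>
    rw [ih2 ht, ih1 (by simpa [Program.avoids] using ht)]
  | loop_neg => rfl

theorem Bounded.write {β : ℕ} {s : Memory} (hs : Bounded β s) (t : ℕ) (i j : ℤ) {v : ℤ}
    (hv : |v| < 2 ^ β) : Bounded β (s.write t i j v) := by
  intro t' i' j'
  unfold Memory.write
  split_ifs
  · exact hv
  · exact hs _ _ _

/-- Started in `s`, provided that all cells of `s` are bounded by `2 ^ β`, the program `c` halts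
after at most `N` steps in a memory that is bounded by `2 ^ β` and satisfies `R`. -/
def Exec (β : ℕ) (c : Program) (s : Memory) (N : ℕ) (R : Memory → Prop) : Prop :=
  Bounded β s → ∃ k s', Run c s k s' ∧ k ≤ N * (c.weight * (β + 2)) ∧ Bounded β s' ∧ R s'

namespace Exec

variable {β : ℕ} {c d : Program} {s : Memory} {N N₁ N₂ : ℕ} {R R' : Memory → Prop}

theorem mono (h : Exec β c s N₁ R') (hN : N₁ ≤ N₂) (hR : ∀ s', R' s' → R s') :
    Exec β c s N₂ R := by
  intro hs
  obtain ⟨k, s', h1, h2, h3, h4⟩ := h hs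
  exact ⟨k, s', h1, h2.trans (Nat.mul_le_mul_right _ hN), h3, hR s' h4⟩

theorem frame (h : Exec β c s N R) :
    Exec β c s N fun s' => R s' ∧ ∀ t, c.avoids t = true → s' t = s t := by
  intro hs
  obtain ⟨k, s', h1, h2, h3, h4⟩ := h hs
  exact ⟨k, s', h1, h2, h3, h4, fun t ht => h1.eq_of_avoids ht⟩

theorem skip (h : R s) : Exec β .skip s 1 R := by
  intro hs
  refine ⟨1, s, Run.skip s, ?_, hs, h⟩
  simp [Program.weight]

theorem store {t : ℕ} {i j e : Expr} (hv : Bounded β s → |e.eval s| < 2 ^ β)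
    (h : R (s.write t (i.eval s) (j.eval s) (e.eval s))) : Exec β (.store t i j e) s 1 R := by
  intro hs
  refine ⟨_, _, Run.store s t i j e, ?_, hs.write _ _ _ (hv hs), h⟩
  have h1 := i.cost_le hs
  have h2 := j.cost_le hs
  have h3 := e.cost_le hs
  simp only [Program.weight]
  nlinarith

theorem seq (hc : Exec β c s N₁ R')
    (hd : ∀ s', (∀ t, c.avoids t = true → s' t = s t) → R' s' → Exec β d s' N₂ R) :
    Exec β (.seq c d) s (N₁ + N₂) R := by
  intro hs
  obtain ⟨k, s', h1, h2, h3, h4, h5⟩ := hc.frame hs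
  obtain ⟨l, s'', g1, g2, g3, g4⟩ := hd s' h5 h4 h3
  refine ⟨k + l, s'', Run.seq h1 g1, ?_, g3, g4⟩
  simp only [Program.weight]
  nlinarith [Nat.zero_le (N₁ * (d.weight * (β + 2))), Nat.zero_le (N₂ * (c.weight * (β + 2)))]

theorem store_seq {t : ℕ} {i j e : Expr} (hv : Bounded β s → |e.eval s| < 2 ^ β)
    (hd : Exec β d (s.write t (i.eval s) (j.eval s) (e.eval s)) N R) :
    Exec β (.seq (.store t i j e) d) s (N + 1) R := by
  rw [add_comm]
  refine seq (R' := fun s' => s' = s.write t (i.eval s) (j.eval s) (e.eval s))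
    (store hv rfl) ?_
  rintro s' - rfl
  exact hd

theorem ite {e : Expr} (hc : 0 < e.eval s → Exec β c s N R)
    (hd : ¬ 0 < e.eval s → Exec β d s N R) : Exec β (.ite e c d) s (N + 1) R := by
  intro hs
  have he := e.cost_le hs
  by_cases h : 0 < e.eval s
  · obtain ⟨k, s', h1, h2, h3, h4⟩ := hc h hs
    refine ⟨_, s', Run.ite_pos h h1, ?_, h3, h4⟩
    simp only [Program.weight]
    have e1 : (N + 1) * ((1 + e.weight ^ 2 + c.weight + d.weight) * (β + 2)) =
        N * (c.weight * (β + 2)) + (1 + e.weight ^ 2) * (β + 2) +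
          (N * (1 + e.weight ^ 2 + d.weight) + c.weight + d.weight) * (β + 2) := by ring
    rw [e1]
    nlinarith [Nat.zero_le ((N * (1 + e.weight ^ 2 + d.weight) + c.weight + d.weight) * (β + 2))]
  · obtain ⟨k, s', h1, h2, h3, h4⟩ := hd h hs
    refine ⟨_, s', Run.ite_neg h h1, ?_, h3, h4⟩
    simp only [Program.weight]
    have e1 : (N + 1) * ((1 + e.weight ^ 2 + c.weight + d.weight) * (β + 2)) =
        N * (d.weight * (β + 2)) + (1 + e.weight ^ 2) * (β + 2) +
          (N * (1 + e.weight ^ 2 + c.weight) + c.weight + d.weight) * (β + 2) := by ring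
    rw [e1]
    nlinarith [Nat.zero_le ((N * (1 + e.weight ^ 2 + c.weight) + c.weight + d.weight) * (β + 2))]

theorem loop {e : Expr} {m : ℕ} {Inv : ℕ → Memory → Prop} (h0 : Inv 0 s)
    (hpos : ∀ i s, i < m → Inv i s → 0 < e.eval s ∧ Exec β c s N (Inv (i + 1)))
    (hneg : ∀ s, Inv m s → ¬ 0 < e.eval s) :
    Exec β (.loop e c) s (m * (N + 1) + 1) (Inv m) := by
  suffices H : ∀ l i s, i + l = m → Inv i s → Exec β (.loop e c) s (l * (N + 1) + 1) (Inv m) from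
    H m 0 s (Nat.zero_add m) h0
  intro l
  induction l with
  | zero =>
    intro i s hi hI hs
    obtain rfl : i = m := by omega
    have he := e.cost_le hs
    refine ⟨_, s, Run.loop_neg (hneg s hI), ?_, hs, hI⟩
    simp only [Program.weight]
    nlinarith [Nat.zero_le (c.weight * (β + 2))]
  | succ l ih =>
    intro i s hi hI hs
    have he := e.cost_le hs
    obtain ⟨hp, hE⟩ := hpos i s (by omega) hI
    obtain ⟨k, s', h1, h2, h3, h4⟩ := hE hs
    obtain ⟨k', s'', g1, g2, g3, g4⟩ := ih (i + 1) s' (by omega) h4 h3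
    refine ⟨_, s'', Run.loop_pos hp h1 g1, ?_, g3, g4⟩
    simp only [Program.weight] at g2 ⊢
    have e1 : ((l + 1) * (N + 1) + 1) * ((1 + e.weight ^ 2 + c.weight) * (β + 2)) =
        (l * (N + 1) + 1) * ((1 + e.weight ^ 2 + c.weight) * (β + 2)) +
        N * (c.weight * (β + 2)) + (1 + e.weight ^ 2) * (β + 2) +
          (N * (1 + e.weight ^ 2) + c.weight) * (β + 2) := by ring
    rw [e1]
    nlinarith [Nat.zero_le ((N * (1 + e.weight ^ 2) + c.weight) * (β + 2))]

end Exec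

/-! ### Counting loops -/

/-- The cell `(0, 0)` of table `t`, used as a variable. -/
def var (t : ℕ) : Expr := .load t (.const 0) (.const 0)

/-- Assignment to a variable. -/
def assign (t : ℕ) (e : Expr) : Program := .store t (.const 0) (.const 0) e

/-- `forLoop t e c` runs `c` with the variable `t` equal to `0, 1, …, e - 1`. -/
def forLoop (t : ℕ) (e : Expr) (c : Program) : Program :=
  .seq (assign t (.const 0))
    (.loop (.sub e (var t)) (.seq c (assign t (.add (var t) (.const 1)))))

/-- A predicate on memories that does not depend on table `t`. -/
def Ignores (t : ℕ) (R : Memory → Prop) : Prop := ∀ s i j v, R s → R (s.write t i j v)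

/-- The bound `e` is evaluated again before each pass; it suffices to know its value in memories
that agree with `s` on the tables the loop never writes. -/
theorem Exec.forLoop {β t m N : ℕ} {e : Expr} {c : Program} {s : Memory}
    (Inv : ℕ → Memory → Prop) (hm : (m : ℤ) < 2 ^ β)
    (he : ∀ s', (∀ t', (RAM.forLoop t e c).avoids t' = true → s' t' = s t') → e.eval s' = m)
    (hi : ∀ i, Ignores t (Inv i)) (hc : c.avoids t = true) (h0 : Inv 0 s)
    (h : ∀ i s', i < m → (∀ t', (RAM.forLoop t e c).avoids t' = true → s' t' = s t') →
      s' t 0 0 = (i : ℤ) → Inv i s' → Exec β c s' N (Inv (i + 1))) :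
    Exec β (RAM.forLoop t e c) s (m * (N + 2) + 2) (Inv m) := by
  have hav : ∀ t', (RAM.forLoop t e c).avoids t' = true → t' ≠ t ∧ c.avoids t' = true := by
    intro t' ht'
    have := ht'
    simp only [RAM.forLoop, assign, Program.avoids, Bool.and_eq_true, bne_iff_ne] at this
    exact ⟨this.1, this.2.1⟩
  have hN : m * (N + 2) + 2 = (m * (N + 1 + 1) + 1) + 1 := by ring
  rw [hN]
  refine Exec.store_seq (by simp [Expr.eval]) ?_
  refine (Exec.loop (N := N + 1) (m := m) (Inv := fun i s' => Inv i s' ∧ s' t 0 0 = (i : ℤ) ∧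
    ∀ t', (RAM.forLoop t e c).avoids t' = true → s' t' = s t') ?_ ?_ ?_).mono le_rfl
    fun s' h' => h'.1
  · refine ⟨hi _ _ _ _ _ h0, by simp [Memory.write_same, Expr.eval], fun t' ht' => ?_⟩
    exact Memory.write_of_ne _ (hav t' ht').1 _ _ _
  · rintro i s' him ⟨hI, hti, hfr⟩
    refine ⟨?_, Exec.seq (h i s' him hfr hti hI) fun s'' hfr' hI' => ?_⟩
    · simp only [Expr.eval, var, he s' hfr, hti]
      omega
    · have hti' : s'' t 0 0 = i := by rw [hfr' t hc, hti]
      refine Exec.store (fun _ => ?_) ⟨hi _ _ _ _ _ hI', ?_, fun t' ht' => ?_⟩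
      · simp only [Expr.eval, var, hti']
        rw [abs_of_nonneg (by omega)]
        omega
      · simp [Memory.write_same, Expr.eval, var, hti']
      · rw [Memory.write_of_ne _ (hav t' ht').1, hfr' t' (hav t' ht').2, hfr t' ht']
  · rintro s' ⟨hI, hti, hfr⟩
    simp [Expr.eval, var, he s' hfr, hti]

/-- `mapLoop u t b e` assigns the value of `e` to the cells `(u, 0)` of table `t`, for `u < b`. -/
def mapLoop (u t : ℕ) (b e : Expr) : Program := forLoop u b (.store t (var u) (.const 0) e)

/-- The invariant also records that the cells not yet visited are unchanged. Hence `e` may read the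
cell it is about to overwrite, as the in-place updates of marginals do. -/
theorem Exec.mapLoop {β u t n : ℕ} {b e : Expr} {s : Memory} (v : ℕ → ℤ) (hut : t ≠ u)
    (hn : (n : ℤ) < 2 ^ β) (hb : ∀ s', (∀ t', t' ≠ u → t' ≠ t → s' t' = s t') → b.eval s' = n)
    (he : ∀ i s', i < n → (∀ t', t' ≠ u → t' ≠ t → s' t' = s t') → s' u 0 0 = (i : ℤ) →
      s' t i 0 = s t i 0 → e.eval s' = v i)
    (hv : ∀ i < n, |v i| < 2 ^ β) :
    Exec β (mapLoop u t b e) s (3 * n + 2) fun s' => ∀ i < n, s' t i 0 = v i := by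
  have hfr : ∀ s' : Memory, (∀ t', (RAM.mapLoop u t b e).avoids t' = true → s' t' = s t') →
      ∀ t', t' ≠ u → t' ≠ t → s' t' = s t' := by
    intro s' h t' h1 h2
    apply h
    simp [RAM.mapLoop, RAM.forLoop, assign, Program.avoids, h1, h2]
  refine (Exec.forLoop (N := 1) (m := n) (fun i s' => (∀ j < i, s' t j 0 = v j) ∧
    ∀ j : ℕ, i ≤ j → s' t j 0 = s t j 0) hn (fun s' h => hb s' (hfr s' h)) ?_ ?_ ?_ ?_).mono
    (by omega) fun s' h => h.1
  · rintro i s' x y z h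
    rwa [Memory.write_of_ne _ hut]
  · simpa [Program.avoids] using hut.symm
  · simp
  · rintro i s' hi h hu ⟨h1, h2⟩
    have hev := he i s' hi (hfr s' h) hu (h2 i le_rfl)
    refine Exec.store (fun _ => hev ▸ hv i hi) ?_
    simp only [Memory.write_same, Expr.eval, var, hu, hev]
    refine ⟨fun j hj => ?_, fun j hj => ?_⟩
    · by_cases hji : j = i
      · simp [hji]
      · have : (j : ℤ) ≠ i := by exact_mod_cast hji
        simp [this, h1 j (by omega)]
    · have : (j : ℤ) ≠ i := by omega
      simp [this, h2 j (by omega)]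

end RAM

/-! ### The algorithm -/

namespace MaxSUB

open RAM Finset

/-- The number of variables. -/
def nE : Expr := .load 0 (.const 0) (.const 0)

/-- The number of squares in the constraint. -/
def kE : Expr := .load 0 (.const 0) (.const 1)

/-- Entry `i` of a vector. -/
def entry (t : ℕ) (i : Expr) : Expr := .load t i (.const 0)

/-- The entry of a symmetrized matrix. -/
def symE (t : ℕ) (i j : Expr) : Expr := .add (.load t i j) (.load t j i)

/-- Table `10` marks the elements exceeding the budget; the others are compared for the best
singleton, which is written to table `5`. -/
def singles : Program :=
  forLoop 22 nE <| .ite (.sub (.load 8 (var 22) (var 22)) (var 9))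
    (.store 10 (var 22) (.const 0) (.const 1)) <|
    .ite (.sub (.load 7 (var 22) (var 22)) (var 11))
      (.seq (assign 11 (.load 7 (var 22) (var 22))) <|
        .seq (.store 5 (var 12) (.const 0) (.const 0)) <|
        .seq (assign 12 (var 22)) <|
        .store 5 (var 12) (.const 0) (.const 1))
      .skip

/-- Finds an unmarked element of maximal density and positive gain. -/
def scan : Program :=
  .seq (assign 18 (.const 0)) <| .seq (assign 19 (.const 1)) <|
  forLoop 22 nE <| .ite (.mul (.sub (.const 1) (entry 10 (var 22)))
      (.sub (.mul (var 19) (entry 13 (var 22))) (.mul (entry 14 (var 22)) (var 18))))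
    (.seq (assign 18 (entry 13 (var 22))) <| .seq (assign 19 (entry 14 (var 22))) <|
      assign 12 (var 22))
    .skip

/-- Adds the element found by `scan` to the greedy solution. -/
def addBest : Program :=
  .seq (assign 17 (.add (var 17) (var 19))) <|
  .seq (assign 16 (.add (var 16) (var 18))) <|
  .seq (.store 15 (var 12) (.const 0) (.const 1)) <|
  .seq (.store 10 (var 12) (.const 0) (.const 1)) <|
  .seq (mapLoop 22 13 nE (.add (entry 13 (var 22)) (symE 7 (var 22) (var 12)))) <|
  mapLoop 22 14 nE (.add (entry 14 (var 22)) (symE 8 (var 22) (var 12)))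

/-- One iteration of the greedy algorithm. -/
def greedyStep : Program :=
  .seq scan <| .ite (.mul (var 18) (.add (.sub (.sub (var 9) (var 17)) (var 19)) (.const 1)))
    addBest .skip

/-- The greedy algorithm on the unmarked elements. -/
def greedy : Program :=
  .seq (mapLoop 22 15 nE (.const 0)) <|
  .seq (mapLoop 22 13 nE (.load 7 (var 22) (var 22))) <|
  .seq (mapLoop 22 14 nE (.load 8 (var 22) (var 22))) <|
  .seq (assign 16 (.const 0)) <|
  .seq (assign 17 (.const 0)) <|
  forLoop 21 nE greedyStep

/-- Replaces the best known solution by the current one if that is better. -/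
def offer : Program :=
  .ite (.sub (var 16) (var 11))
    (.seq (assign 11 (var 16)) <| mapLoop 22 5 nE (entry 15 (var 22))) .skip

/-- The loss in value when element `i` of the current solution is removed. -/
def lossE (i : Expr) : Expr := .sub (entry 13 i) (.mul (.const 2) (.load 7 i i))

/-- One iteration of the double greedy algorithm. -/
def doubleStep : Program :=
  .ite (entry 15 (var 21))
    (.ite (.add (.add (entry 20 (var 21)) (lossE (var 21))) (.const 1))
      (mapLoop 22 20 nE (.add (entry 20 (var 22)) (symE 7 (var 22) (var 21))))
      (.seq (assign 16 (.sub (var 16) (lossE (var 21)))) <|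
        .seq (.store 15 (var 21) (.const 0) (.const 0)) <|
        mapLoop 22 13 nE (.sub (entry 13 (var 22)) (symE 7 (var 22) (var 21)))))
    .skip

/-- The double greedy algorithm on the current solution. -/
def doubleGreedy : Program :=
  .seq (mapLoop 22 20 nE (.load 7 (var 22) (var 22))) <| forLoop 21 nE doubleStep

/-! ### Correctness of the parts -/

/-- The assumptions on the scaled instance, with `β` the bound on the word length. -/
structure Scaled (n : ℕ) (a Q : ℕ → ℕ → ℤ) (c : ℤ) (β : ℕ) : Prop where
  n_lt : (n : ℤ) < 2 ^ β
  offDiag : ∀ i j, i ≠ j → a i j ≤ 0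
  nonneg : ∀ i j, 0 ≤ Q i j
  cross : CrossBound Q
  c_pos : 0 < c
  c_lt : c < 2 ^ β
  one_lt : (1 : ℤ) < 2 ^ β
  quad_lt : ∀ S ⊆ range n, |quad a S| < 2 ^ β
  marg_lt : ∀ e, ∀ S ⊆ range n, |marg a e S| < 2 ^ β
  marg_lt' : ∀ e, ∀ S ⊆ range n, |marg Q e S| < 2 ^ β

/-- The memory contains the scaled instance. -/
def Ready (n : ℕ) (a Q : ℕ → ℕ → ℤ) (c : ℤ) (s : Memory) : Prop :=
  s 0 0 0 = n ∧ (∀ i < n, ∀ j < n, s 7 i j = a i j) ∧ (∀ i < n, ∀ j < n, s 8 i j = Q i j) ∧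
    s 9 0 0 = c

/-- Column `0` of table `t` contains the vector `v`. -/
def Holds (n t : ℕ) (v : ℕ → ℤ) (s : Memory) : Prop := ∀ e < n, s t e 0 = v e

/-- The indicator function of a set. -/
def ind (S : Finset ℕ) (e : ℕ) : ℤ := if e ∈ S then 1 else 0

/-- A feasible solution of value `b` is stored in table `5`. -/
def Out (n : ℕ) (a Q : ℕ → ℕ → ℤ) (c b : ℤ) (s : Memory) : Prop :=
  s 11 0 0 = b ∧ ∃ X ⊆ range n, quad Q X ≤ c ∧ quad a X = b ∧ Holds n 5 (ind X) s

section

variable {n β : ℕ} {a Q : ℕ → ℕ → ℤ} {c : ℤ} {s s' : Memory}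

theorem Ready.of_eq (h : Ready n a Q c s) (h0 : s' 0 = s 0) (h7 : s' 7 = s 7) (h8 : s' 8 = s 8)
    (h9 : s' 9 = s 9) : Ready n a Q c s' := by
  simpa only [Ready, h0, h7, h8, h9] using h

theorem Holds.of_eq {t : ℕ} {v : ℕ → ℤ} (h : Holds n t v s) (ht : s' t = s t) :
    Holds n t v s' := by
  simpa only [Holds, ht] using h

theorem Out.of_eq {b : ℤ} (h : Out n a Q c b s) (h5 : s' 5 = s 5) (h11 : s' 11 = s 11) :
    Out n a Q c b s' := by
  simpa only [Out, Holds, h5, h11] using h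

theorem Holds.write {t : ℕ} {S T : Finset ℕ} (h : Holds n t (ind S) s) {i : ℕ} {v : ℤ}
    (hv : v = ind T i) (hT : ∀ e, e ≠ i → (e ∈ T ↔ e ∈ S)) :
    Holds n t (ind T) (s.write t i 0 v) := by
  intro e he
  rw [Memory.write_same]
  by_cases hei : e = i
  · subst hei; simp [hv]
  · have : (e : ℤ) ≠ i := by exact_mod_cast hei
    simp [this, h e he, ind, hT e hei]

theorem ind_lt (hP : Scaled n a Q c β) (S : Finset ℕ) (e : ℕ) : |ind S e| < 2 ^ β := by
  have := hP.one_lt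
  unfold ind
  split_ifs <;> simp
  linarith

theorem exec_offer {b : ℤ} {S : Finset ℕ} (hP : Scaled n a Q c β) (hr : Ready n a Q c s)
    (ho : Out n a Q c b s) (hS : S ⊆ range n) (hQS : quad Q S ≤ c)
    (hv : s 16 0 0 = quad a S) (hx : Holds n 15 (ind S) s) :
    Exec β offer s (3 * n + 4) fun s' =>
      ∃ b', b ≤ b' ∧ quad a S ≤ b' ∧ Out n a Q c b' s' := by
  refine Exec.ite (fun h => ?_) (fun h => ?_)
  · simp only [Expr.eval, var, hv, ho.1] at h
    refine (Exec.store_seq (N := 3 * n + 2)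
      (fun _ => by simpa [Expr.eval, var, hv] using hP.quad_lt S hS) ?_)
    refine (Exec.mapLoop (n := n) (ind S) (by decide) hP.n_lt ?_ ?_ fun i _ => ind_lt hP S i).frame.mono
      le_rfl ?_
    · intro s' h'
      simp [nE, Expr.eval, h' 0 (by decide) (by decide), Memory.write_of_ne, hr.1]
    · intro i s' hi h' hu _
      simp [entry, var, Expr.eval, h' 15 (by decide) (by decide), hu, Memory.write_of_ne, hx i hi]
    · rintro s' ⟨h5, hfr⟩
      refine ⟨quad a S, by linarith, le_rfl, ?_, S, hS, hQS, rfl, h5⟩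
      rw [hfr 11 rfl]
      simp [Memory.write_same, Expr.eval, var, hv]
  · simp only [Expr.eval, var, hv, ho.1] at h
    exact (Exec.skip ⟨b, le_rfl, by linarith, ho⟩).mono (by omega) fun _ h => h

/-- Among the elements smaller than `k` and not in `W`, either none has positive gain `F`, or the
variables `12`, `18` and `19` describe one of maximal density `F / H`. -/
def Best (k n : ℕ) (W : Finset ℕ) (F H : ℕ → ℤ) (s : Memory) : Prop :=
  (s 18 0 0 = 0 ∧ s 19 0 0 = 1 ∧ ∀ e < k, e ∉ W → F e ≤ 0) ∨
  ∃ i < n, i ∉ W ∧ s 12 0 0 = i ∧ s 18 0 0 = F i ∧ s 19 0 0 = H i ∧ 0 < F i ∧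
    ∀ e < k, e ∉ W → H i * F e ≤ H e * F i

/-- Transitivity of the density order in cross-multiplied form. A budget use may be zero, so one
cancels the positive gain `Fi` rather than a denominator. -/
theorem densest_trans {Fi Hi Fe He Fj Hj : ℤ} (hHe : 0 ≤ He) (hHj : 0 ≤ Hj) (hFe : 0 < Fe)
    (hFi : 0 < Fi) (h1 : He * Fi < Hi * Fe) (h2 : Hi * Fj ≤ Hj * Fi) : He * Fj ≤ Hj * Fe := by
  rcases le_or_gt Fj 0 with hj | hj
  · nlinarith [mul_nonneg hHj hFe.le, mul_nonneg hHe (neg_nonneg.2 hj)]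
  · refine le_of_mul_le_mul_right ?_ hFi
    nlinarith [mul_le_mul_of_nonneg_right h1.le hj.le, mul_le_mul_of_nonneg_right h2 hFe.le]

theorem exec_scan {W : Finset ℕ} {F H : ℕ → ℤ} (hP : Scaled n a Q c β)
    (hr : s 0 0 0 = n) (hu : Holds n 10 (ind W) s) (hF : Holds n 13 F s) (hH : Holds n 14 H s)
    (hH0 : ∀ e, 0 ≤ H e) : Exec β scan s (6 * n + 4) (Best n n W F H) := by
  have h1 := hP.one_lt
  refine Exec.store_seq (N := 6 * n + 3) (fun _ => by simp [Expr.eval]) ?_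
  refine Exec.store_seq (N := 6 * n + 2) (fun _ => by simpa [Expr.eval] using h1) ?_
  refine (Exec.forLoop (N := 4) (m := n) (fun i s' => Best i n W F H s') hP.n_lt ?_ ?_ rfl
    ?_ ?_).mono (by omega) fun _ h => h
  · intro s' h
    simp [nE, Expr.eval, h 0 rfl, Memory.write_of_ne, hr]
  · intro i s' x y z h
    simpa [Best, Memory.write_of_ne] using h
  · left
    simp [Memory.write_of_ne, Memory.write_same, Expr.eval]
  · intro i s' hi hfr hvar hI
    have e10 : s' 10 i 0 = ind W i := by
      rw [hfr 10 rfl]; simpa [Memory.write_of_ne] using hu i hi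
    have e13 : s' 13 i 0 = F i := by
      rw [hfr 13 rfl]; simpa [Memory.write_of_ne] using hF i hi
    have e14 : s' 14 i 0 = H i := by
      rw [hfr 14 rfl]; simpa [Memory.write_of_ne] using hH i hi
    have lt_succ : ∀ {P : ℕ → Prop}, (∀ e < i, P e) → P i → ∀ e < i + 1, P e := by
      intro P h1 h2 e he
      rcases Nat.lt_succ_iff_lt_or_eq.1 he with h | rfl
      · exact h1 e h
      · exact h2
    refine Exec.ite (N := 3) (fun h => ?_) (fun h => ?_)
    · simp only [Expr.eval, entry, var, hvar, e10, e13, e14] at h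
      have hiW : i ∉ W := by
        intro hiW
        simp [ind, hiW] at h
      simp only [ind, hiW, if_false, sub_zero, one_mul, sub_pos] at h
      refine Exec.store_seq (N := 2) (fun hs => hs _ _ _) ?_
      refine Exec.store_seq (N := 1) (fun hs => hs _ _ _) ?_
      refine Exec.store (fun hs => hs _ _ _) ?_
      have key : 0 < F i ∧ ∀ e < i + 1, e ∉ W → H i * F e ≤ H e * F i := by
        rcases hI with ⟨e18, e19, hI⟩ | ⟨j, hj, hjW, e12, e18, e19, hFj, hI⟩
        -- The initial pair (0, 1) turns the density comparison into a test for positive gain.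
        · have hFi : 0 < F i := by simpa [e18, e19] using h
          refine ⟨hFi, lt_succ (fun e he heW => ?_) fun _ => le_rfl⟩
          nlinarith [mul_nonneg (hH0 i) (neg_nonneg.2 (hI e he heW)),
            mul_nonneg (hH0 e) hFi.le]
        · rw [e18, e19] at h
          have hFi : 0 < F i := by
            by_contra hneg
            nlinarith [mul_nonneg (hH0 j) (neg_nonneg.2 (not_lt.1 hneg)),
              mul_nonneg (hH0 i) hFj.le]
          refine ⟨hFi, lt_succ (fun e he heW => ?_) fun _ => le_rfl⟩
          exact densest_trans (hH0 i) (hH0 e) hFi hFj h (hI e he heW)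
      refine Or.inr ⟨i, hi, hiW, ?_, ?_, ?_, key⟩
      all_goals
        simp [Memory.write_of_ne, Memory.write_same, Expr.eval, entry, var, hvar, e13, e14]
    · simp only [Expr.eval, entry, var, hvar, e10, e13, e14] at h
      refine (Exec.skip ?_).mono (by omega : 1 ≤ 3) fun _ h => h
      rcases hI with ⟨e18, e19, hI⟩ | ⟨j, hj, hjW, e12, e18, e19, hFj, hI⟩
      · refine Or.inl ⟨e18, e19, lt_succ hI fun hiW => ?_⟩
        simpa [ind, hiW, e18, e19] using h
      · refine Or.inr ⟨j, hj, hjW, e12, e18, e19, hFj, lt_succ hI fun hiW => ?_⟩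
        simpa [ind, hiW, e18, e19] using h

/-- The state of the greedy algorithm with current solution `S`, where the elements of `U` are
excluded. -/
def GreedyState (n : ℕ) (a : ℕ → ℕ → ℤ) (U S : Finset ℕ) (s : Memory) : Prop :=
  Holds n 10 (ind (U ∪ S)) s ∧ Holds n 15 (ind S) s ∧ Holds n 13 (fun e => marg a e S) s ∧
    s 16 0 0 = quad a S

theorem exec_addBest {U S : Finset ℕ} {i : ℕ} (hP : Scaled n a Q c β) (hr : Ready n a Q c s)
    (hg : GreedyState n a U S s) (hH : Holds n 14 (fun e => marg Q e S) s)
    (hcap : s 17 0 0 = quad Q S) (hS : S ⊆ range n) (hi : i < n) (hiS : i ∉ S)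
    (h12 : s 12 0 0 = i) (h18 : s 18 0 0 = marg a i S) (h19 : s 19 0 0 = marg Q i S)
    (hfit : quad Q S + marg Q i S ≤ c) :
    Exec β addBest s (6 * n + 8) fun s' => GreedyState n a U (insert i S) s' ∧
      Holds n 14 (fun e => marg Q e (insert i S)) s' ∧ s' 17 0 0 = quad Q (insert i S) := by
  obtain ⟨h10, h15, h13, h16⟩ := hg
  have hS' : insert i S ⊆ range n := insert_subset (mem_range.2 hi) hS
  have h1 := hP.one_lt
  have hq := quad_insert (a := a) hiS
  have hq' := quad_insert (a := Q) hiS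
  refine Exec.store_seq (N := 6 * n + 7) (fun _ => ?_) ?_
  · simp only [Expr.eval, var, hcap, h19]
    have := hP.c_lt
    rw [abs_of_nonneg (add_nonneg (quad_nonneg hP.nonneg S) (marg_nonneg hP.nonneg i S))]
    linarith
  refine Exec.store_seq (N := 6 * n + 6) (fun _ => ?_) ?_
  · have := hP.quad_lt _ hS'
    rw [hq] at this
    simpa [Expr.eval, var, Memory.write_of_ne, h16, h18] using this
  refine Exec.store_seq (N := 6 * n + 5) (fun _ => by simpa [Expr.eval] using h1) ?_
  refine Exec.store_seq (N := 6 * n + 4) (fun _ => by simpa [Expr.eval] using h1) ?_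
  have h15' := h15.write (T := insert i S) (i := i) (v := 1) (by simp [ind])
    (fun e he => by simp [he])
  have h10' := h10.write (T := U ∪ insert i S) (i := i) (v := 1) (by simp [ind])
    (fun e he => by simp [he])
  rw [show 6 * n + 4 = (3 * n + 2) + (3 * n + 2) by ring]
  refine Exec.seq (Exec.mapLoop (n := n) (fun e => marg a e (insert i S)) (by decide) hP.n_lt ?_ ?_
    fun e _ => hP.marg_lt e _ hS') fun s₁ hfr₁ h13' => ?_
  · intro s' h'
    simp [nE, Expr.eval, h' 0 (by decide) (by decide), Memory.write_of_ne, hr.1]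
  · intro e s' he h' hu h13e
    simp [entry, symE, var, Expr.eval, h' 7 (by decide) (by decide), h' 12 (by decide) (by decide),
      hu, Memory.write_of_ne, h12, h13e, h13 e he, hr.2.1 e he i hi, hr.2.1 i hi e he,
      marg_insert e hiS]
  refine (Exec.mapLoop (n := n) (fun e => marg Q e (insert i S)) (by decide) hP.n_lt ?_ ?_
    fun e _ => hP.marg_lt' e _ hS').frame.mono le_rfl ?_
  · intro s' h'
    simp [nE, Expr.eval, h' 0 (by decide) (by decide), hfr₁ 0 rfl, Memory.write_of_ne, hr.1]
  · intro e s' he h' hu h14e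
    have h14 : s₁ 14 e 0 = marg Q e S := by
      rw [hfr₁ 14 rfl]; simpa [Memory.write_of_ne] using hH e he
    simp [entry, symE, var, Expr.eval, h' 8 (by decide) (by decide), h' 12 (by decide) (by decide),
      hfr₁ 8 rfl, hfr₁ 12 rfl, hu, Memory.write_of_ne, h12, h14e, h14, hr.2.2.1 e he i hi,
      hr.2.2.1 i hi e he, marg_insert e hiS]
  · rintro s' ⟨h14', hfr₂⟩
    refine ⟨⟨?_, ?_, ?_, ?_⟩, h14', ?_⟩
    · refine h10'.of_eq ?_
      rw [hfr₂ 10 rfl, hfr₁ 10 rfl]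
      funext x y
      simp [Memory.write, Expr.eval, var, h12]
    · refine h15'.of_eq ?_
      rw [hfr₂ 15 rfl, hfr₁ 15 rfl]
      funext x y
      simp [Memory.write, Expr.eval, var, h12]
    · intro e he
      rw [hfr₂ 13 rfl, h13' e he]
    · rw [hfr₂ 16 rfl, hfr₁ 16 rfl]
      simp [Memory.write_of_ne, Memory.write_same, Expr.eval, var, h16, h18, hq]
    · rw [hfr₂ 17 rfl, hfr₁ 17 rfl]
      simp [Memory.write_of_ne, Memory.write_same, Expr.eval, var, hcap, h19, hq']

/-- What is known about the greedy solution `S` on the ground set `range n \ U`. -/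
structure GreedySol (n : ℕ) (a Q : ℕ → ℕ → ℤ) (c : ℤ) (U S : Finset ℕ) : Prop where
  subset : S ⊆ range n \ U
  feasible : quad Q S ≤ c
  nonneg : 0 ≤ quad a S
  diag : ∀ e ∈ S, 0 ≤ a e e

/-- The loop has no early exit. Either the guarantee already holds, and then it survives further
insertions, or every pass so far has added an element, which is what `S.card = r` counts. -/
theorem exec_greedyStep {m : ℤ} {U S : Finset ℕ} (hP : Scaled n a Q c β) (hr : Ready n a Q c s)
    (hm : 0 ≤ m) (hU : ∀ e ∈ range n \ U, a e e ≤ m)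
    (hg : GreedyState n a U S s) (hH : Holds n 14 (fun e => marg Q e S) s)
    (hcap : s 17 0 0 = quad Q S) (hS : GreedySol n a Q c U S)
    (hinv : GreedyInv a Q c (range n \ U) S) {r : ℕ}
    (hcard : GreedyBound a Q c m (range n \ U) S ∨ S.card = r) :
    Exec β greedyStep s (12 * n + 13) fun s' => ∃ S, GreedyState n a U S s' ∧
      Holds n 14 (fun e => marg Q e S) s' ∧ s' 17 0 0 = quad Q S ∧ GreedySol n a Q c U S ∧
      GreedyInv a Q c (range n \ U) S ∧
      (GreedyBound a Q c m (range n \ U) S ∨ S.card = r + 1) := by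
  have hSn : S ⊆ range n := hS.subset.trans sdiff_subset
  rw [show 12 * n + 13 = (6 * n + 4) + ((6 * n + 8) + 1) by ring]
  refine Exec.seq (exec_scan hP hr.1 hg.1 hg.2.2.1 hH fun e => marg_nonneg hP.nonneg e S)
    fun s₁ hfr hb => ?_
  have hr₁ : Ready n a Q c s₁ := hr.of_eq (hfr 0 rfl) (hfr 7 rfl) (hfr 8 rfl) (hfr 9 rfl)
  have hg₁ : GreedyState n a U S s₁ := ⟨hg.1.of_eq (hfr 10 rfl), hg.2.1.of_eq (hfr 15 rfl),
    hg.2.2.1.of_eq (hfr 13 rfl), by rw [hfr 16 rfl, hg.2.2.2]⟩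
  have hH₁ := hH.of_eq (hfr 14 rfl)
  have hcap₁ : s₁ 17 0 0 = quad Q S := by rw [hfr 17 rfl, hcap]
  rcases hb with ⟨h18, h19, hb⟩ | ⟨i, hi, hiW, h12, h18, h19, hF, hb⟩
  · have hbd : GreedyBound a Q c m (range n \ U) S := by
      refine greedyBound_of_no_gain hP.offDiag hm hS.nonneg fun e he => ?_
      simp only [mem_sdiff, mem_range] at he
      exact hb e he.1.1 (by simp [he.1.2, he.2])
    refine Exec.ite (fun h => ?_) fun h => (Exec.skip ?_).mono (by omega) fun _ h => h
    · simp [Expr.eval, var, h18] at h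
    · exact ⟨S, hg₁, hH₁, hcap₁, hS, hinv, Or.inl hbd⟩
  · simp only [mem_union, not_or] at hiW
    have hbest : ∀ e ∈ (range n \ U) \ S,
        marg Q i S * marg a e S ≤ marg Q e S * marg a i S := by
      intro e he
      simp only [mem_sdiff, mem_range] at he
      exact hb e he.1.1 (by simp [he.1.2, he.2])
    refine Exec.ite (fun h => ?_) fun h => (Exec.skip ?_).mono (by omega) fun _ h => h
    · simp only [Expr.eval, var, h18, h19, hcap₁, hr₁.2.2.2] at h
      -- The test multiplies the positive gain by the remaining budget plus one; over the integers,
      -- positivity of the latter means that the element fits.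
      have hfit : quad Q S + marg Q i S ≤ c := by
        have := (mul_pos_iff_of_pos_left hF).1 h
        linarith [Int.lt_iff_add_one_le.1 this]
      refine (exec_addBest hP hr₁ hg₁ hH₁ hcap₁ hSn hi hiW.2 h12 h18 h19 hfit).mono le_rfl ?_
      rintro s' ⟨g1, g2, g3⟩
      refine ⟨insert i S, g1, g2, g3, ⟨?_, ?_, ?_, ?_⟩, ?_, ?_⟩
      · exact insert_subset (by simp [hi, hiW.1]) hS.subset
      · rwa [quad_insert hiW.2]
      · rw [quad_insert hiW.2]; linarith [hS.nonneg]
      · intro e he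
        rcases mem_insert.1 he with rfl | he
        · have := marg_anti hP.offDiag (empty_subset S) hiW.2
          rw [marg_empty] at this
          linarith
        · exact hS.diag e he
      · exact hinv.insert_elem hP.offDiag hP.nonneg hP.cross hP.c_pos hiW.2 hF.le hbest
      · rcases hcard with h | h
        · exact Or.inl (h.insert_elem hiW.2 hF.le)
        · right
          rw [card_insert_of_notMem hiW.2, h]
    · simp only [Expr.eval, var, h18, h19, hcap₁, hr₁.2.2.2] at h
      refine ⟨S, hg₁, hH₁, hcap₁, hS, hinv, Or.inl ?_⟩
      refine hinv.bound_of_not_fit hP.offDiag hP.nonneg hP.cross hP.c_pos hiW.2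
        (hU i (by simp [hi, hiW.1])) hS.nonneg hF.le hbest ?_
      by_contra hfit
      exact h (mul_pos hF (by linarith))

theorem exec_greedy {m : ℤ} {U : Finset ℕ} (hP : Scaled n a Q c β) (hr : Ready n a Q c s)
    (hm : 0 ≤ m) (hU : ∀ e ∈ range n \ U, a e e ≤ m) (hu : Holds n 10 (ind U) s) :
    Exec β greedy s ((12 * n + 24) * n + 10) fun s' => ∃ S, GreedyState n a U S s' ∧
      GreedySol n a Q c U S ∧ GreedyBound a Q c m (range n \ U) S := by
  have hb : ∀ t : ℕ, t ≠ 0 → ∀ s₀ : Memory, s₀ 0 = s 0 → ∀ s' : Memory,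
      (∀ t', t' ≠ 22 → t' ≠ t → s' t' = s₀ t') → nE.eval s' = n := by
    intro t ht s₀ h0 s' h
    simp [nE, Expr.eval, h 0 (by decide) ht.symm, h0, hr.1]
  rw [show (12 * n + 24) * n + 10 =
    (3 * n + 2) + ((3 * n + 2) + ((3 * n + 2) + (((n * (12 * n + 15) + 2) + 1) + 1))) by ring]
  refine Exec.seq (Exec.mapLoop (n := n) (ind ∅) (by decide) hP.n_lt (hb 15 (by decide) s rfl) ?_
    fun i _ => ind_lt hP ∅ i) fun s₁ hf₁ h15 => ?_
  · intro i s' _ _ _ _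
    simp [Expr.eval, ind]
  refine Exec.seq (Exec.mapLoop (n := n) (fun e => marg a e ∅) (by decide) hP.n_lt
    (hb 13 (by decide) s₁ (hf₁ 0 rfl)) ?_ fun i _ => hP.marg_lt i ∅ (empty_subset _))
    fun s₂ hf₂ h13 => ?_
  · intro i s' hi h' hu' _
    simp [Expr.eval, var, hu', h' 7 (by decide) (by decide), hf₁ 7 rfl, hr.2.1 i hi i hi]
  refine Exec.seq (Exec.mapLoop (n := n) (fun e => marg Q e ∅) (by decide) hP.n_lt
    (hb 14 (by decide) s₂ (by rw [hf₂ 0 rfl, hf₁ 0 rfl])) ?_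
    fun i _ => hP.marg_lt' i ∅ (empty_subset _)) fun s₃ hf₃ h14 => ?_
  · intro i s' hi h' hu' _
    simp [Expr.eval, var, hu', h' 8 (by decide) (by decide), hf₂ 8 rfl, hf₁ 8 rfl,
      hr.2.2.1 i hi i hi]
  refine Exec.store_seq (fun _ => by simp [Expr.eval]) ?_
  refine Exec.store_seq (fun _ => by simp [Expr.eval]) ?_
  have hfr : ∀ t, (mapLoop 22 15 nE (.const 0)).avoids t = true →
      (mapLoop 22 13 nE (.load 7 (var 22) (var 22))).avoids t = true →
      (mapLoop 22 14 nE (.load 8 (var 22) (var 22))).avoids t = true → s₃ t = s t :=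
    fun t h1 h2 h3 => by rw [hf₃ t h3, hf₂ t h2, hf₁ t h1]
  refine (Exec.forLoop (N := 12 * n + 13) (m := n) (fun r s' => ∃ S, GreedyState n a U S s' ∧
      Holds n 14 (fun e => marg Q e S) s' ∧ s' 17 0 0 = quad Q S ∧ GreedySol n a Q c U S ∧
      GreedyInv a Q c (range n \ U) S ∧
      (GreedyBound a Q c m (range n \ U) S ∨ S.card = r)) hP.n_lt ?_ ?_ rfl ?_ ?_).mono le_rfl ?_
  · intro s' h
    simp [nE, Expr.eval, h 0 rfl, Memory.write_of_ne, hfr 0 rfl rfl rfl, hr.1]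
  · intro i s' x y z h
    simpa [GreedyState, Holds, Memory.write_of_ne] using h
  · refine ⟨∅, ⟨?_, ?_, ?_, ?_⟩, ?_, ?_, ⟨by simp, by simpa using hP.c_pos.le, by simp, by simp⟩,
      greedyInv_empty c _, Or.inr rfl⟩
    · rw [union_empty]
      exact hu.of_eq (by simp [Memory.write_of_ne, hfr 10 rfl rfl rfl])
    · intro e he
      simp [Memory.write_of_ne, hf₃ 15 rfl, hf₂ 15 rfl, h15 e he]
    · intro e he
      simp [Memory.write_of_ne, hf₃ 13 rfl, h13 e he]
    · simp [Memory.write_of_ne, Memory.write_same, Expr.eval]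
    · intro e he
      simp [Memory.write_of_ne, h14 e he]
    · simp [Memory.write_same, Expr.eval]
  · rintro r s' hr' hfr' - ⟨S, g1, g2, g3, g4, g5, g6⟩
    have hr₄ : Ready n a Q c s' := by
      refine hr.of_eq ?_ ?_ ?_ ?_
      · rw [hfr' 0 rfl]; simp [Memory.write_of_ne, hfr 0 rfl rfl rfl]
      · rw [hfr' 7 rfl]; simp [Memory.write_of_ne, hfr 7 rfl rfl rfl]
      · rw [hfr' 8 rfl]; simp [Memory.write_of_ne, hfr 8 rfl rfl rfl]
      · rw [hfr' 9 rfl]; simp [Memory.write_of_ne, hfr 9 rfl rfl rfl]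
    exact exec_greedyStep hP hr₄ hm hU g1 g2 g3 g4 g5 g6
  · rintro s' ⟨S, g1, -, -, g4, -, g6⟩
    refine ⟨S, g1, g4, ?_⟩
    rcases g6 with h | h
    · exact h
    -- If all `n` passes added an element, nothing is left, so there is vacuously no element of
    -- positive gain.
    · have hSn : S = range n :=
        eq_of_subset_of_card_le (g4.subset.trans sdiff_subset) (by simp [h])
      refine greedyBound_of_no_gain hP.offDiag hm g4.nonneg fun e he => ?_
      rw [hSn] at he
      simp at he

/-- The elements of `range k` that exceed the budget. -/
def big (Q : ℕ → ℕ → ℤ) (c : ℤ) (k : ℕ) : Finset ℕ := (range k).filter fun e => c < Q e e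

theorem mem_big_succ {k e : ℕ} (h : e ≠ k) : e ∈ big Q c (k + 1) ↔ e ∈ big Q c k := by
  simp only [big, mem_filter, mem_range]
  constructor <;> rintro ⟨h1, h2⟩ <;> exact ⟨by omega, h2⟩

theorem exec_singles (hP : Scaled n a Q c β) (hr : Ready n a Q c s)
    (hz : ∀ t i j, 9 < t → t < 13 → s t i j = 0) (hz5 : ∀ i j, s 5 i j = 0) :
    Exec β singles s (8 * n + 2) fun s' => ∃ m, 0 ≤ m ∧ Holds n 10 (ind (big Q c n)) s' ∧
      (∀ e ∈ range n \ big Q c n, a e e ≤ m) ∧ Out n a Q c m s' := by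
  have h1 := hP.one_lt
  refine (Exec.forLoop (N := 6) (m := n) (fun k s' => Holds n 10 (ind (big Q c k)) s' ∧
    0 ≤ s' 11 0 0 ∧ (∀ e < k, Q e e ≤ c → a e e ≤ s' 11 0 0) ∧ ∃ b : ℕ, s' 12 0 0 = b ∧
    ((s' 11 0 0 = 0 ∧ Holds n 5 (ind ∅) s') ∨
      (b < n ∧ Q b b ≤ c ∧ s' 11 0 0 = a b b ∧ Holds n 5 (ind {b}) s')))
    hP.n_lt ?_ ?_ rfl ?_ ?_).mono (by omega) ?_
  · intro s' h
    simp [nE, Expr.eval, h 0 rfl, hr.1]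
  · intro i s' x y z h
    simpa [Holds, Memory.write_of_ne] using h
  · refine ⟨fun e _ => ?_, ?_, by simp, 0, ?_, Or.inl ⟨?_, fun e _ => ?_⟩⟩
    · simp [hz, big, ind]
    all_goals simp [hz, hz5, ind]
  · rintro k s' hk hfr hvar ⟨h10, hm0, hm, b, h12, hout⟩
    have hr' : Ready n a Q c s' := hr.of_eq (hfr 0 rfl) (hfr 7 rfl) (hfr 8 rfl) (hfr 9 rfl)
    have hkk := hr'.2.2.1 k hk k hk
    have hak := hr'.2.1 k hk k hk
    refine Exec.ite (N := 5) (fun h => ?_) (fun h => ?_)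
    · simp only [Expr.eval, var, hvar, hkk, hr'.2.2.2, sub_pos] at h
      refine (Exec.store (fun _ => by simpa [Expr.eval] using h1) ?_).mono
        (by omega : 1 ≤ 5) fun _ h => h
      simp only [Expr.eval, var, hvar]
      refine ⟨h10.write (by simp [ind, big, h]) fun e he => mem_big_succ he, ?_⟩
      simp only [Holds, Memory.write_of_ne, ne_eq, Nat.reduceEqDiff, not_false_eq_true]
      refine ⟨hm0, fun e he hQe => ?_, b, h12, hout⟩
      rcases Nat.lt_succ_iff_lt_or_eq.1 he with he | rfl
      · exact hm e he hQe
      · linarith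
    · simp only [Expr.eval, var, hvar, hkk, hr'.2.2.2, sub_pos, not_lt] at h
      have hbig : Holds n 10 (ind (big Q c (k + 1))) s' := by
        have : big Q c (k + 1) = big Q c k := by
          rw [big, range_add_one, filter_insert, if_neg (not_lt.2 h), big]
        rwa [this]
      refine Exec.ite (N := 4) (fun h' => ?_) (fun h' => ?_)
      · simp only [Expr.eval, var, hvar, hak, sub_pos] at h'
        refine Exec.store_seq (N := 3) (fun hs => hs _ _ _) ?_
        refine Exec.store_seq (N := 2) (fun hs => by simp [Expr.eval]) ?_
        refine Exec.store_seq (N := 1) (fun hs => hs _ _ _) ?_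
        refine Exec.store (fun hs => by simpa [Expr.eval] using h1) ?_
        -- Clearing the cell of the previous best element is harmless when no singleton has been
        -- stored yet.
        have h5 : Holds n 5 (ind ∅) (s'.write 5 b 0 0) := by
          rcases hout with ⟨-, ho⟩ | ⟨-, -, -, ho⟩
          · exact ho.write (by simp [ind]) fun e _ => Iff.rfl
          · exact ho.write (by simp [ind]) fun e he => by simp [he]
        have h5' := h5.write (T := {k}) (i := k) (v := 1) (by simp [ind])
          fun e he => by simp [he]
        refine ⟨?_, ?_, ?_, k, ?_, Or.inr ⟨hk, h, ?_, ?_⟩⟩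
        · intro e he
          simpa [Memory.write_of_ne] using hbig e he
        · simp [Memory.write_of_ne, Memory.write_same, Expr.eval, var, hvar, hak]
          linarith
        · intro e he hQe
          simp only [Memory.write_of_ne, Memory.write_same, Expr.eval, var, hvar, hak, ne_eq,
            Nat.reduceEqDiff, not_false_eq_true, and_self, if_true]
          rcases Nat.lt_succ_iff_lt_or_eq.1 he with he | rfl
          · exact (hm e he hQe).trans h'.le
          · exact le_rfl
        · simp [Memory.write_of_ne, Memory.write_same, Expr.eval, var, hvar]
        · simp [Memory.write_of_ne, Memory.write_same, Expr.eval, var, hvar, hak]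
        · intro e he
          rw [← h5' e he]
          simp [Memory.write, Expr.eval, var, hvar, h12]
      · simp only [Expr.eval, var, hvar, hak, sub_pos, not_lt] at h'
        refine (Exec.skip ⟨hbig, hm0, fun e he hQe => ?_, b, h12, hout⟩).mono
          (by omega : 1 ≤ 4) fun _ h => h
        rcases Nat.lt_succ_iff_lt_or_eq.1 he with he | rfl
        · exact hm e he hQe
        · exact h'
  · rintro s' ⟨h10, hm0, hm, b, -, hout⟩
    refine ⟨s' 11 0 0, hm0, h10, fun e he => ?_, rfl, ?_⟩
    · simp only [mem_sdiff, big, mem_filter, mem_range, not_and, not_lt] at he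
      exact hm e he.1 (he.2 he.1)
    · rcases hout with ⟨h0, ho⟩ | ⟨hb, hQb, h0, ho⟩
      · exact ⟨∅, by simp, by simpa using hP.c_pos.le, by simp [h0], ho⟩
      · exact ⟨{b}, by simpa using hb, by simpa [quad_singleton] using hQb,
          by simp [h0, quad_singleton], ho⟩

/-- The state of the double greedy algorithm on the ground set `S₁` after `k` steps. -/
def DoubleState (n : ℕ) (a : ℕ → ℕ → ℤ) (S₁ : Finset ℕ) (k : ℕ) (s : Memory) : Prop :=
  ∃ X Y, X ⊆ Y ∧ Y ⊆ S₁ ∧ (∀ e ∈ Y, e < k → e ∈ X) ∧ (∀ e ∈ X, e < k) ∧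
    Holds n 20 (fun e => marg a e X) s ∧ Holds n 13 (fun e => marg a e Y) s ∧
    Holds n 15 (ind Y) s ∧ s 16 0 0 = quad a Y ∧ DoubleInv a S₁ X Y

theorem exec_doubleStep {S₁ : Finset ℕ} {k : ℕ} (hP : Scaled n a Q c β) (hr : Ready n a Q c s)
    (hS₁ : S₁ ⊆ range n) (hk : k < n) (hvar : s 21 0 0 = k) (h : DoubleState n a S₁ k s) :
    Exec β doubleStep s (3 * n + 6) (DoubleState n a S₁ (k + 1)) := by
  obtain ⟨X, Y, hXY, hY, hYX, hXk, h20, h13, h15, h16, hinv⟩ := h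
  have hkX : k ∉ X := fun h => lt_irrefl k (hXk k h)
  have hak := hr.2.1 k hk k hk
  have hloss : (lossE (var 21)).eval s = marg a k Y - 2 * a k k := by
    simp [lossE, entry, var, Expr.eval, hvar, h13 k hk, hak]
  have hlt : ∀ Z : Finset ℕ, (∀ e ∈ Z, e < k) → ∀ e ∈ Z, e < k + 1 :=
    fun Z h e he => Nat.lt_succ_of_lt (h e he)
  refine Exec.ite (N := 3 * n + 5) (fun hx => ?_) (fun hx => ?_)
  · have hkY : k ∈ Y := by
      by_contra hkY
      simp [entry, var, Expr.eval, hvar, h15 k hk, ind, hkY] at hx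
    refine Exec.ite (N := 3 * n + 4) (fun hg => ?_) (fun hg => ?_)
    -- The program adds one before testing positivity, so a tie inserts the element.
    · have hg' : 0 ≤ marg a k X + (marg a k Y - 2 * a k k) := by
        have : (0 : ℤ) < marg a k X + (marg a k Y - 2 * a k k) + 1 := by
          rw [Expr.eval, Expr.eval, Expr.eval, hloss] at hg
          simpa [entry, var, Expr.eval, hvar, h20 k hk] using hg
        omega
      have hX' : insert k X ⊆ range n :=
        insert_subset (mem_range.2 hk) ((hXY.trans hY).trans hS₁)
      refine (Exec.mapLoop (n := n) (fun e => marg a e (insert k X)) (by decide) hP.n_lt ?_ ?_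
        fun e _ => hP.marg_lt e _ hX').frame.mono (by omega) ?_
      · intro s' h'
        simp [nE, Expr.eval, h' 0 (by decide) (by decide), hr.1]
      · intro e s' he h' hu h20e
        simp [entry, symE, var, Expr.eval, h' 7 (by decide) (by decide),
          h' 21 (by decide) (by decide), hu, hvar, h20e, h20 e he, hr.2.1 e he k hk,
          hr.2.1 k hk e he, marg_insert e hkX]
      · rintro s' ⟨h20', hfr⟩
        refine ⟨insert k X, Y, insert_subset hkY hXY, hY, fun e he hek => ?_, fun e he => ?_, h20',
          h13.of_eq (hfr 13 rfl), h15.of_eq (hfr 15 rfl), by rw [hfr 16 rfl, h16],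
          hinv.insert_elem hP.offDiag hXY hkX hkY hg'⟩
        · rcases Nat.lt_succ_iff_lt_or_eq.1 hek with h | rfl
          · exact mem_insert_of_mem (hYX e he h)
          · exact mem_insert_self _ _
        · rcases mem_insert.1 he with rfl | he
          · exact Nat.lt_succ_self _
          · exact hlt X hXk e he
    · have hg' : marg a k X + (marg a k Y - 2 * a k k) ≤ 0 := by
        have : ¬ (0 : ℤ) < marg a k X + (marg a k Y - 2 * a k k) + 1 := by
          rw [Expr.eval, Expr.eval, Expr.eval, hloss] at hg
          simpa [entry, var, Expr.eval, hvar, h20 k hk] using hg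
        omega
      have hY' : Y.erase k ⊆ range n := (erase_subset _ _).trans (hY.trans hS₁)
      refine Exec.store_seq (N := 3 * n + 3) (fun _ => ?_) ?_
      · have := hP.quad_lt _ hY'
        rw [quad_erase hkY] at this
        simp only [Expr.eval, hloss]
        simpa [var, Expr.eval, h16] using this
      refine Exec.store_seq (N := 3 * n + 2) (fun _ => by simp [Expr.eval]) ?_
      have h15' := h15.write (T := Y.erase k) (i := k) (v := 0) (by simp [ind])
        fun e he => by simp [he]
      refine (Exec.mapLoop (n := n) (fun e => marg a e (Y.erase k)) (by decide) hP.n_lt ?_ ?_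
        fun e _ => hP.marg_lt e _ hY').frame.mono le_rfl ?_
      · intro s' h'
        simp [nE, Expr.eval, h' 0 (by decide) (by decide), Memory.write_of_ne, hr.1]
      · intro e s' he h' hu h13e
        simp [entry, symE, var, Expr.eval, h' 7 (by decide) (by decide), Memory.write_of_ne,
          h' 21 (by decide) (by decide), hu, hvar, h13e, h13 e he, hr.2.1 e he k hk,
          hr.2.1 k hk e he, marg_erase e hkY]
      · rintro s' ⟨h13', hfr⟩
        refine ⟨X, Y.erase k, subset_erase.2 ⟨hXY, hkX⟩, (erase_subset _ _).trans hY,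
          fun e he hek => ?_, hlt X hXk, ?_, h13', ?_, ?_,
          hinv.erase_elem hP.offDiag hXY hkX hkY hg'⟩
        · obtain ⟨h1, h2⟩ := mem_erase.1 he
          exact hYX e h2 (by omega)
        · refine h20.of_eq ?_
          rw [hfr 20 rfl]
          simp [Memory.write_of_ne]
        · refine h15'.of_eq ?_
          rw [hfr 15 rfl]
          funext x y
          simp [Memory.write, Expr.eval, var, hvar]
        · rw [hfr 16 rfl, quad_erase hkY, ← hloss, ← h16]
          simp [Memory.write_of_ne, Memory.write_same, Expr.eval, var]
  · have hkY : k ∉ Y := by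
      intro hkY
      simp [entry, var, Expr.eval, hvar, h15 k hk, ind, hkY] at hx
    refine (Exec.skip ⟨X, Y, hXY, hY, fun e he hek => ?_, hlt X hXk, h20, h13, h15, h16,
      hinv⟩).mono (by omega) fun _ h => h
    have : e ≠ k := fun h => hkY (h ▸ he)
    exact hYX e he (by omega)

theorem exec_doubleGreedy {U S₁ : Finset ℕ} (hP : Scaled n a Q c β) (hr : Ready n a Q c s)
    (hS₁ : S₁ ⊆ range n) (hg : GreedyState n a U S₁ s) :
    Exec β doubleGreedy s ((3 * n + 11) * n + 4) fun s' => ∃ X ⊆ S₁, Holds n 15 (ind X) s' ∧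
      s' 16 0 0 = quad a X ∧ DoubleInv a S₁ X X := by
  rw [show (3 * n + 11) * n + 4 = (3 * n + 2) + (n * ((3 * n + 6) + 2) + 2) by ring]
  refine Exec.seq (Exec.mapLoop (n := n) (fun e => marg a e ∅) (by decide) hP.n_lt ?_ ?_
    fun e _ => hP.marg_lt e _ (empty_subset _)) fun s₁ hf₁ h20 => ?_
  · intro s' h'
    simp [nE, Expr.eval, h' 0 (by decide) (by decide), hr.1]
  · intro i s' hi h' hu' _
    simp [Expr.eval, var, hu', h' 7 (by decide) (by decide), hr.2.1 i hi i hi]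
  have hr₁ : Ready n a Q c s₁ := hr.of_eq (hf₁ 0 rfl) (hf₁ 7 rfl) (hf₁ 8 rfl) (hf₁ 9 rfl)
  refine (Exec.forLoop (N := 3 * n + 6) (m := n) (DoubleState n a S₁) hP.n_lt ?_ ?_ rfl
    ?_ ?_).mono le_rfl ?_
  · intro s' h
    simp [nE, Expr.eval, h 0 rfl, hr₁.1]
  · intro i s' x y z h
    simpa [DoubleState, Holds, Memory.write_of_ne] using h
  · exact ⟨∅, S₁, empty_subset _, subset_rfl, by simp, by simp, h20, hg.2.2.1.of_eq (hf₁ 13 rfl),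
      hg.2.1.of_eq (hf₁ 15 rfl), by rw [hf₁ 16 rfl, hg.2.2.2], doubleInv_init S₁⟩
  · intro k s' hk hfr hvar h
    exact exec_doubleStep hP (hr₁.of_eq (hfr 0 rfl) (hfr 7 rfl) (hfr 8 rfl) (hfr 9 rfl)) hS₁ hk
      hvar h
  · rintro s' ⟨X, Y, hXY, hY, hYX, -, -, -, h15, h16, hinv⟩
    -- After `n` steps every index has been decided, so each survivor in `Y` belongs to `X`.
    have : X = Y := subset_antisymm hXY fun e he => hYX e he (mem_range.1 (hS₁ (hY he)))
    subst this
    exact ⟨X, hY, h15, h16, hinv⟩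

/-- The algorithm on the scaled instance. -/
def solve : Program :=
  .seq singles <| .seq greedy <| .seq offer <| .seq doubleGreedy <| .seq offer <|
    .seq greedy offer

theorem exec_solve (hP : Scaled n a Q c β) (hr : Ready n a Q c s)
    (hV : ∀ S ⊆ range n, (∀ e ∈ S, 0 ≤ a e e) → 0 ≤ quad a S)
    (hz : ∀ t i j, 9 < t → t < 13 → s t i j = 0) (hz5 : ∀ i j, s 5 i j = 0) :
    Exec β solve s (27 * n ^ 2 + 76 * n + 38) fun s' => ∃ b, Out n a Q c b s' ∧
      ∀ O ⊆ range n, quad Q O ≤ c → quad a O ≤ 14 * b := by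
  rw [show 27 * n ^ 2 + 76 * n + 38 = (8 * n + 2) + (((12 * n + 24) * n + 10) + ((3 * n + 4) +
    (((3 * n + 11) * n + 4) + ((3 * n + 4) + (((12 * n + 24) * n + 10) + (3 * n + 4)))))) by ring]
  refine Exec.seq (exec_singles hP hr hz hz5) ?_
  rintro s₁ f₁ ⟨m, hm0, hu₁, hm, ho₁⟩
  have r₁ : Ready n a Q c s₁ := hr.of_eq (f₁ 0 rfl) (f₁ 7 rfl) (f₁ 8 rfl) (f₁ 9 rfl)
  refine Exec.seq (exec_greedy hP r₁ hm0 hm hu₁) ?_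
  rintro s₂ f₂ ⟨S₁, hg₁, hS₁, hb₁⟩
  have r₂ : Ready n a Q c s₂ := r₁.of_eq (f₂ 0 rfl) (f₂ 7 rfl) (f₂ 8 rfl) (f₂ 9 rfl)
  have hS₁n : S₁ ⊆ range n := hS₁.subset.trans sdiff_subset
  refine Exec.seq (exec_offer hP r₂ (ho₁.of_eq (f₂ 5 rfl) (f₂ 11 rfl)) hS₁n hS₁.feasible
    hg₁.2.2.2 hg₁.2.1) ?_
  rintro s₃ f₃ ⟨b₃, hmb₃, hSb₃, ho₃⟩
  have r₃ : Ready n a Q c s₃ := r₂.of_eq (f₃ 0 rfl) (f₃ 7 rfl) (f₃ 8 rfl) (f₃ 9 rfl)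
  have hg₃ : GreedyState n a (big Q c n) S₁ s₃ := ⟨hg₁.1.of_eq (f₃ 10 rfl),
    hg₁.2.1.of_eq (f₃ 15 rfl), hg₁.2.2.1.of_eq (f₃ 13 rfl), by rw [f₃ 16 rfl, hg₁.2.2.2]⟩
  refine Exec.seq (exec_doubleGreedy hP r₃ hS₁n hg₃) ?_
  rintro s₄ f₄ ⟨X, hX, hx₄, hv₄, hinv⟩
  have r₄ : Ready n a Q c s₄ := r₃.of_eq (f₄ 0 rfl) (f₄ 7 rfl) (f₄ 8 rfl) (f₄ 9 rfl)
  refine Exec.seq (exec_offer hP r₄ (ho₃.of_eq (f₄ 5 rfl) (f₄ 11 rfl)) (hX.trans hS₁n)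
    ((quad_mono hP.nonneg hX).trans hS₁.feasible) hv₄ hx₄) ?_
  rintro s₅ f₅ ⟨b₅, hbb₅, hXb₅, ho₅⟩
  have r₅ : Ready n a Q c s₅ := r₄.of_eq (f₅ 0 rfl) (f₅ 7 rfl) (f₅ 8 rfl) (f₅ 9 rfl)
  -- Greedy leaves its own choices marked, and double greedy does not touch the marks. The second
  -- run therefore avoids all of `S₁`, including the elements removed from the current solution.
  have hu₅ : Holds n 10 (ind (big Q c n ∪ S₁)) s₅ :=
    (hg₃.1.of_eq (f₄ 10 rfl)).of_eq (f₅ 10 rfl)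
  have hm' : ∀ e ∈ range n \ (big Q c n ∪ S₁), a e e ≤ m := fun e he =>
    hm e (sdiff_subset_sdiff subset_rfl subset_union_left he)
  refine Exec.seq (exec_greedy hP r₅ hm0 hm' hu₅) ?_
  rintro s₆ f₆ ⟨S₂, hg₂, hS₂, hb₂⟩
  have r₆ : Ready n a Q c s₆ := r₅.of_eq (f₆ 0 rfl) (f₆ 7 rfl) (f₆ 8 rfl) (f₆ 9 rfl)
  have hS₂n : S₂ ⊆ range n := hS₂.subset.trans sdiff_subset
  refine (exec_offer hP r₆ (ho₅.of_eq (f₆ 5 rfl) (f₆ 11 rfl)) hS₂n hS₂.feasible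
    hg₂.2.2.2 hg₂.2.1).mono le_rfl ?_
  rintro s₇ ⟨b, hbb, hSb, ho⟩
  refine ⟨b, ho, fun O hO hQO => ?_⟩
  refine (quad_le_quad_filter hP.offDiag O).trans ?_
  have hO' : O.filter (fun i => 0 ≤ a i i) ⊆ O := filter_subset _ _
  have hd : Disjoint S₁ S₂ := by
    refine Finset.disjoint_left.2 fun e h1 h2 => ?_
    have := (mem_sdiff.1 (hS₂.subset h2)).2
    exact this (mem_union_right _ h1)
  rw [← Finset.sup_eq_union, ← sdiff_sdiff_left] at hb₂
  -- `V` consists of the elements with non-negative diagonal entry, on which the objective is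
  -- non-negative. Both greedy solutions lie in it because a positive gain forces a positive
  -- diagonal entry.
  refine quad_le_fourteen_mul hP.offDiag hP.nonneg (c := c) (m := m)
    (V := (range n).filter fun e => 0 ≤ a e e) (G := range n \ big Q c n) (S₁ := S₁) (S₂ := S₂)
    (X := X) ?_ ?_ ?_ ((quad_mono hP.nonneg hO').trans hQO) hb₁ hb₂ ?_ ?_ hd hinv
    (by linarith) (by linarith) hSb (by linarith)
  · intro S hS
    exact hV S (hS.trans (filter_subset _ _)) fun e he => (mem_filter.1 (hS he)).2
  · intro e he
    have heO := hO' he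
    refine mem_sdiff.2 ⟨hO heO, fun hbig => ?_⟩
    have h1 : quad Q {e} ≤ quad Q O := quad_mono hP.nonneg (by simpa using heO)
    rw [quad_singleton] at h1
    have := (mem_filter.1 hbig).2
    linarith
  · exact fun e he => mem_filter.2 ⟨hO (hO' he), (mem_filter.1 he).2⟩
  · exact fun e he => mem_filter.2 ⟨hS₁n he, hS₁.diag e he⟩
  · exact fun e he => mem_filter.2 ⟨hS₂n he, hS₂.diag e he⟩

end

end MaxSUB

/-! ### Loops over matrices -/

namespace RAM

/-- `mapLoop₂ u₁ u₂ t b₁ b₂ e` assigns the value of `e` to the cells `(u₁, u₂)` of table `t`, for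
`u₁ < b₁` and `u₂ < b₂`. -/
def mapLoop₂ (u₁ u₂ t : ℕ) (b₁ b₂ e : Expr) : Program :=
  forLoop u₁ b₁ (forLoop u₂ b₂ (.store t (var u₁) (var u₂) e))

/-- Again `e` may read its target cell; this is how the Gram matrix is accumulated row by row of
`p`. -/
theorem Exec.mapLoop₂ {β u₁ u₂ t m n : ℕ} {b₁ b₂ e : Expr} {s : Memory} (v : ℕ → ℕ → ℤ)
    (h₁ : t ≠ u₁) (h₂ : t ≠ u₂) (h₁₂ : u₁ ≠ u₂) (hm : (m : ℤ) < 2 ^ β) (hn : (n : ℤ) < 2 ^ β)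
    (hb₁ : ∀ s', (∀ t', t' ≠ u₁ → t' ≠ u₂ → t' ≠ t → s' t' = s t') → b₁.eval s' = m)
    (hb₂ : ∀ s', (∀ t', t' ≠ u₁ → t' ≠ u₂ → t' ≠ t → s' t' = s t') → b₂.eval s' = n)
    (he : ∀ i j s', i < m → j < n → (∀ t', t' ≠ u₁ → t' ≠ u₂ → t' ≠ t → s' t' = s t') →
      s' u₁ 0 0 = (i : ℤ) → s' u₂ 0 0 = (j : ℤ) → s' t i j = s t i j → e.eval s' = v i j)
    (hv : ∀ i < m, ∀ j < n, |v i j| < 2 ^ β) :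
    Exec β (mapLoop₂ u₁ u₂ t b₁ b₂ e) s (m * (3 * n + 4) + 2) fun s' =>
      ∀ i < m, ∀ j < n, s' t i j = v i j := by
  have hav : ∀ t', t' ≠ u₁ → t' ≠ u₂ → t' ≠ t →
      (RAM.mapLoop₂ u₁ u₂ t b₁ b₂ e).avoids t' = true := by
    intro t' g1 g2 g3
    simp [RAM.mapLoop₂, RAM.forLoop, assign, Program.avoids, g1, g2, g3]
  have hav' : ∀ t', t' ≠ u₂ → t' ≠ t →
      (RAM.forLoop u₂ b₂ (.store t (var u₁) (var u₂) e)).avoids t' = true := by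
    intro t' g2 g3
    simp [RAM.forLoop, assign, Program.avoids, g2, g3]
  refine (Exec.forLoop (N := 3 * n + 2) (m := m)
    (fun k s' => (∀ i < k, ∀ j < n, s' t i j = v i j) ∧
      ∀ i j : ℕ, k ≤ i → s' t i j = s t i j) hm
    (fun s' h => hb₁ s' fun t' g1 g2 g3 => h t' (hav t' g1 g2 g3)) ?_ (hav' u₁ h₁₂ h₁.symm) ?_
    ?_).mono (le_of_eq (by ring)) fun s' h => h.1
  · rintro i s' x y z h
    rwa [Memory.write_of_ne _ h₁]
  · simp
  · rintro k s' hk hfr hu₁ ⟨hlt, hge⟩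
    refine (Exec.forLoop (N := 1) (m := n)
      (fun l s' => ((∀ i < k, ∀ j < n, s' t i j = v i j) ∧ (∀ j < l, s' t k j = v k j)) ∧
        ∀ i j : ℕ, k ≤ i → (i = k → l ≤ j) → s' t i j = s t i j) hn
      (fun s'' h => hb₂ s'' fun t' g1 g2 g3 => ?_) ?_ ?_ ?_ ?_).mono (le_of_eq (by ring))
      fun s'' h => ?_
    · rw [h t' (hav' t' g2 g3), hfr t' (hav t' g1 g2 g3)]
    · rintro i s' x y z h
      rwa [Memory.write_of_ne _ h₂]
    · simpa [Program.avoids] using h₂.symm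
    · exact ⟨⟨hlt, by simp⟩, fun i j hi _ => hge i j hi⟩
    · rintro l s'' hl hfr'' hu₂ ⟨⟨i1, i2⟩, i3⟩
      have hu₁' : s'' u₁ 0 0 = k := by rw [hfr'' u₁ (hav' u₁ h₁₂ h₁.symm), hu₁]
      have hev := he k l s'' hk hl (fun t' g1 g2 g3 => by
        rw [hfr'' t' (hav' t' g2 g3), hfr t' (hav t' g1 g2 g3)]) hu₁' hu₂
        (i3 k l le_rfl fun _ => le_rfl)
      refine Exec.store (fun _ => hev ▸ hv k hk l hl) ?_
      simp only [Memory.write_same, Expr.eval, var, hu₁', hu₂, hev]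
      refine ⟨⟨fun i hi j hj => ?_, fun j hj => ?_⟩, fun i j hi hj => ?_⟩
      · rw [if_neg (by omega), i1 i hi j hj]
      · by_cases hjl : j = l
        · simp [hjl]
        · rw [if_neg (by omega), i2 j (by omega)]
      · rw [if_neg, i3 i j hi fun h => (by have := hj h; omega)]
        rintro ⟨g1, g2⟩
        have := hj (by omega)
        omega
    · obtain ⟨⟨i1, i2⟩, i3⟩ := h
      refine ⟨fun i hi j hj => ?_, fun i j hi => i3 i j (by omega) (by omega)⟩
      rcases Nat.lt_succ_iff_lt_or_eq.1 hi with h | rfl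
      · exact i1 i h j hj
      · exact i2 j hj

/-- Multiplies the variable `w` by all entries of the matrix in table `t`. -/
def prodLoop (u₁ u₂ w t : ℕ) (b₁ b₂ : Expr) : Program :=
  forLoop u₁ b₁ (forLoop u₂ b₂ (assign w (.mul (var w) (.load t (var u₁) (var u₂)))))

/-- Every intermediate product divides the final one, which is positive; so the bound on the final
product bounds all of them. -/
theorem Exec.prodLoop {β u₁ u₂ w t m n : ℕ} {b₁ b₂ : Expr} {s : Memory} (v : ℕ → ℕ → ℤ) {d : ℤ}
    (h₁ : w ≠ u₁) (h₂ : w ≠ u₂) (h₁₂ : u₁ ≠ u₂) (ht₁ : t ≠ u₁) (ht₂ : t ≠ u₂) (htw : t ≠ w)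
    (hm : (m : ℤ) < 2 ^ β) (hn : (n : ℤ) < 2 ^ β)
    (hb₁ : ∀ s', (∀ t', t' ≠ u₁ → t' ≠ u₂ → t' ≠ w → s' t' = s t') → b₁.eval s' = m)
    (hb₂ : ∀ s', (∀ t', t' ≠ u₁ → t' ≠ u₂ → t' ≠ w → s' t' = s t') → b₂.eval s' = n)
    (hv : ∀ i < m, ∀ j < n, s t i j = v i j) (hd : s w 0 0 = d)
    (hpos : 0 < d * ∏ i ∈ Finset.range m, ∏ j ∈ Finset.range n, v i j)
    (hlt : d * ∏ i ∈ Finset.range m, ∏ j ∈ Finset.range n, v i j < 2 ^ β) :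
    Exec β (prodLoop u₁ u₂ w t b₁ b₂) s (m * (3 * n + 4) + 2) fun s' =>
      s' w 0 0 = d * ∏ i ∈ Finset.range m, ∏ j ∈ Finset.range n, v i j := by
  have hav : ∀ t', t' ≠ u₁ → t' ≠ u₂ → t' ≠ w →
      (RAM.prodLoop u₁ u₂ w t b₁ b₂).avoids t' = true := by
    intro t' g1 g2 g3
    simp [RAM.prodLoop, RAM.forLoop, assign, Program.avoids, g1, g2, g3]
  have hav' : ∀ t', t' ≠ u₂ → t' ≠ w → (RAM.forLoop u₂ b₂
      (assign w (.mul (var w) (.load t (var u₁) (var u₂))))).avoids t' = true := by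
    intro t' g2 g3
    simp [RAM.forLoop, assign, Program.avoids, g2, g3]
  refine (Exec.forLoop (N := 3 * n + 2) (m := m)
    (fun k s' => s' w 0 0 = d * ∏ i ∈ Finset.range k, ∏ j ∈ Finset.range n, v i j) hm
    (fun s' h => hb₁ s' fun t' g1 g2 g3 => h t' (hav t' g1 g2 g3)) ?_ (hav' u₁ h₁₂ h₁.symm) ?_
    ?_).mono (le_of_eq (by ring)) fun s' h => h
  · rintro i s' x y z h
    rwa [Memory.write_of_ne _ h₁]
  · simpa using hd
  · rintro k s' hk hfr hu₁ hw
    refine (Exec.forLoop (N := 1) (m := n)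
      (fun l s' => s' w 0 0 = d * (∏ i ∈ Finset.range k, ∏ j ∈ Finset.range n, v i j) *
        ∏ j ∈ Finset.range l, v k j) hn
      (fun s'' h => hb₂ s'' fun t' g1 g2 g3 => ?_) ?_ ?_ ?_ ?_).mono (le_of_eq (by ring))
      fun s'' h => ?_
    · rw [h t' (hav' t' g2 g3), hfr t' (hav t' g1 g2 g3)]
    · rintro i s' x y z h
      rwa [Memory.write_of_ne _ h₂]
    · simpa [assign, Program.avoids] using h₂.symm
    · simpa using hw
    · rintro l s'' hl hfr'' hu₂ hw'
      have hu₁' : s'' u₁ 0 0 = k := by rw [hfr'' u₁ (hav' u₁ h₁₂ h₁.symm), hu₁]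
      have hev : (Expr.mul (var w) (.load t (var u₁) (var u₂))).eval s'' =
          d * (∏ i ∈ Finset.range k, ∏ j ∈ Finset.range n, v i j) *
            ∏ j ∈ Finset.range (l + 1), v k j := by
        simp only [Expr.eval, var, hu₁', hu₂, hw', hfr'' t (hav' t ht₂ htw),
          hfr t (hav t ht₁ ht₂ htw), hv k hk l hl]
        rw [Finset.prod_range_succ, mul_assoc]
      refine Exec.store (fun _ => ?_) ?_
      · rw [hev]
        refine lt_of_le_of_lt ?_ hlt
        refine Int.le_of_dvd hpos ((abs_dvd _ _).2 ?_)
        rw [mul_assoc]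
        refine mul_dvd_mul_left d (dvd_trans (mul_dvd_mul_left _ ?_)
          (?_ : _ * ∏ j ∈ Finset.range n, v k j ∣ _))
        · exact Finset.prod_dvd_prod_of_subset _ _ _ (Finset.range_mono hl)
        · rw [← Finset.prod_range_succ]
          exact Finset.prod_dvd_prod_of_subset _ _ _ (Finset.range_mono hk)
      · rw [hev]
        simp [Memory.write_same, Expr.eval]
    · rw [h, Finset.prod_range_succ, mul_assoc]

end RAM

/-! ### Scaling to an integer instance -/

namespace MaxSUB

open RAM Finset

/-- The scaled entry of a matrix of rationals with numerators in table `t` and denominators in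
table `t'`. -/
def scaledE (t t' : ℕ) (i j : Expr) : Expr := .mul (.load t i j) (.div (var 6) (.load t' i j))

/-- Scales the instance to integers: table `6` contains the product of all denominators, table `7`
the matrix of the objective, table `8` the matrix of the constraint and table `9` the budget. -/
def prepare : Program :=
  .seq (assign 6 (.const 1)) <|
  .seq (prodLoop 21 22 6 2 nE nE) <|
  .seq (prodLoop 21 22 6 4 kE nE) <|
  .seq (assign 9 (.mul (.load 0 (.const 1) (.const 0)) (.mul (var 6) (var 6)))) <|
  .seq (mapLoop₂ 21 22 7 nE nE (scaledE 1 2 (var 21) (var 22))) <|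
  forLoop 23 kE <| mapLoop₂ 21 22 8 nE nE (.add (.load 8 (var 21) (var 22))
    (.mul (.load 0 (.const 1) (.const 1))
      (.mul (scaledE 3 4 (var 23) (var 21)) (scaledE 3 4 (var 23) (var 22)))))

/-- The integer `D * q`, for a multiple `D` of the denominator of `q`. -/
def scale (D : ℤ) (q : ℚ) : ℤ := q.num * (D / q.den)

/-- The matrix `Pᵀ P`, scaled, from the first `k` rows. -/
def gram (D d : ℤ) (p : ℕ → ℕ → ℚ) (k : ℕ) (i j : ℕ) : ℤ :=
  d * ∑ l ∈ range k, scale D (p l i) * scale D (p l j)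

/-- The product of all denominators. -/
def denProd (n K : ℕ) (A p : ℕ → ℕ → ℚ) : ℤ :=
  (∏ i ∈ range n, ∏ j ∈ range n, ((A i j).den : ℤ)) *
    ∏ k ∈ range K, ∏ j ∈ range n, ((p k j).den : ℤ)

theorem denProd_pos (n K : ℕ) (A p : ℕ → ℕ → ℚ) : 0 < denProd n K A p := by
  refine mul_pos ?_ ?_ <;>
  exact prod_pos fun i _ => prod_pos fun j _ => by exact_mod_cast Rat.den_pos _

theorem exec_prepare {n K β : ℕ} {A p : ℕ → ℕ → ℚ} {C : ℚ} {s : Memory}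
    (h0 : s 0 0 0 = n) (h0K : s 0 0 1 = K) (h0C : s 0 1 0 = C.num) (h0D : s 0 1 1 = C.den)
    (h1 : ∀ i < n, ∀ j < n, s 1 i j = (A i j).num) (h2 : ∀ i < n, ∀ j < n, s 2 i j = (A i j).den)
    (h3 : ∀ i < K, ∀ j < n, s 3 i j = (p i j).num) (h4 : ∀ i < K, ∀ j < n, s 4 i j = (p i j).den)
    (h8 : ∀ i j, s 8 i j = 0) (hn : (n : ℤ) < 2 ^ β) (hK : (K : ℤ) < 2 ^ β)
    (one_lt : (1 : ℤ) < 2 ^ β)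
    (hD : denProd n K A p < 2 ^ β)
    (hc : |C.num * (denProd n K A p * denProd n K A p)| < 2 ^ β)
    (ha : ∀ i j, |scale (denProd n K A p) (A i j)| < 2 ^ β)
    (hQ : ∀ k ≤ K, ∀ i j, |gram (denProd n K A p) C.den p k i j| < 2 ^ β) :
    Exec β prepare s (2 * (n * (3 * n + 4)) + K * (3 * n + 4) +
        K * (n * (3 * n + 4) + 4) + 10)
      (Ready n (fun i j => scale (denProd n K A p) (A i j)) (gram (denProd n K A p) C.den p K)
        (C.num * (denProd n K A p * denProd n K A p))) := by
  set D := denProd n K A p with hDdef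
  have hD1 : ∏ i ∈ range n, ∏ j ∈ range n, ((A i j).den : ℤ) ≤ D := by
    refine Int.le_of_dvd (denProd_pos n K A p) (Dvd.intro _ rfl)
  have hD0 : 0 < ∏ i ∈ range n, ∏ j ∈ range n, ((A i j).den : ℤ) :=
    prod_pos fun i _ => prod_pos fun j _ => by exact_mod_cast Rat.den_pos _
  rw [show 2 * (n * (3 * n + 4)) + K * (3 * n + 4) + K * (n * (3 * n + 4) + 4) + 10 =
    ((n * (3 * n + 4) + 2) + ((K * (3 * n + 4) + 2) + (((n * (3 * n + 4) + 2) +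
      (K * ((n * (3 * n + 4) + 2) + 2) + 2)) + 1))) + 1 by ring]
  refine Exec.store_seq (fun _ => by simpa [Expr.eval] using one_lt) ?_
  refine Exec.seq (Exec.prodLoop (m := n) (n := n) (fun i j => ((A i j).den : ℤ)) (d := 1)
    (by decide) (by decide) (by decide) (by decide) (by decide) (by decide) hn hn ?_ ?_ ?_ ?_ ?_ ?_)
    fun s₁ f₁ h6 => ?_
  · intro s' h'
    simp [nE, Expr.eval, h' 0 (by decide) (by decide) (by decide), Memory.write_of_ne, h0]
  · intro s' h'
    simp [nE, Expr.eval, h' 0 (by decide) (by decide) (by decide), Memory.write_of_ne, h0]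
  · intro i hi j hj
    simp [Memory.write_of_ne, h2 i hi j hj]
  · simp [Memory.write_same, Expr.eval]
  · rwa [one_mul]
  · rw [one_mul]
    linarith
  rw [one_mul] at h6
  have g₁ : ∀ t, t ≠ 6 → t ≠ 21 → t ≠ 22 → s₁ t = s t := by
    intro t e1 e2 e3
    rw [f₁ t (by simp [prodLoop, forLoop, assign, Program.avoids, e1, e2, e3]),
      Memory.write_of_ne _ e1]
  refine Exec.seq (Exec.prodLoop (m := K) (n := n) (fun i j => ((p i j).den : ℤ))
    (by decide) (by decide) (by decide) (by decide) (by decide) (by decide) hK hn ?_ ?_ ?_ h6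
    (denProd_pos n K A p) hD) fun s₂ f₂ h6' => ?_
  · intro s' h'
    simp [kE, Expr.eval, h' 0 (by decide) (by decide) (by decide), g₁ 0, h0K]
  · intro s' h'
    simp [nE, Expr.eval, h' 0 (by decide) (by decide) (by decide), g₁ 0, h0]
  · intro i hi j hj
    simp [g₁ 4, h4 i hi j hj]
  change s₂ 6 0 0 = D at h6'
  have g₂ : ∀ t, t ≠ 6 → t ≠ 21 → t ≠ 22 → s₂ t = s t := by
    intro t e1 e2 e3
    rw [f₂ t (by simp [prodLoop, forLoop, assign, Program.avoids, e1, e2, e3]), g₁ t e1 e2 e3]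
  refine Exec.store_seq (fun _ => ?_) ?_
  · simpa [Expr.eval, var, h6', g₂ 0, h0C] using hc
  refine Exec.seq (Exec.mapLoop₂ (m := n) (n := n) (fun i j => scale D (A i j)) (by decide)
    (by decide) (by decide) hn hn ?_ ?_ ?_ fun i _ j _ => ha i j) fun s₃ f₃ h7 => ?_
  · intro s' h'
    simp [nE, Expr.eval, h' 0 (by decide) (by decide) (by decide), Memory.write_of_ne, g₂ 0, h0]
  · intro s' h'
    simp [nE, Expr.eval, h' 0 (by decide) (by decide) (by decide), Memory.write_of_ne, g₂ 0, h0]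
  · intro i j s' hi hj h' hu₁ hu₂ _
    simp [scaledE, var, Expr.eval, hu₁, hu₂, h' 1 (by decide) (by decide) (by decide),
      h' 2 (by decide) (by decide) (by decide), h' 6 (by decide) (by decide) (by decide),
      Memory.write_of_ne, g₂ 1, g₂ 2, h6', h1 i hi j hj, h2 i hi j hj, scale]
  have g₃ : ∀ t, t ≠ 6 → t ≠ 21 → t ≠ 22 → t ≠ 9 → t ≠ 7 → s₃ t = s t := by
    intro t e1 e2 e3 e4 e5
    rw [f₃ t (by simp [mapLoop₂, forLoop, assign, Program.avoids, e2, e3, e5]),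
      Memory.write_of_ne _ e4, g₂ t e1 e2 e3]
  have h6₃ : s₃ 6 0 0 = D := by rw [f₃ 6 rfl, Memory.write_of_ne _ (by decide), h6']
  have h9₃ : s₃ 9 0 0 = C.num * (D * D) := by
    rw [f₃ 9 rfl]
    simp [Memory.write_same, Expr.eval, var, h6', g₂ 0, h0C]
  refine (Exec.forLoop (N := n * (3 * n + 4) + 2) (m := K)
    (fun k s' => ∀ i < n, ∀ j < n, s' 8 i j = gram D C.den p k i j) hK ?_ ?_ rfl ?_ ?_).frame.mono
    le_rfl ?_
  · intro s' h'
    simp [kE, Expr.eval, h' 0 rfl, g₃ 0, h0K]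
  · intro i s' x y z h
    simpa [Memory.write_of_ne] using h
  · intro i hi j hj
    simp [g₃ 8, h8, gram]
  · intro k s' hk f₄ hu₃ hI
    refine Exec.mapLoop₂ (m := n) (n := n) _ (by decide) (by decide) (by decide) hn hn ?_ ?_ ?_
      fun i _ j _ => hQ (k + 1) hk i j
    · intro s' h'
      simp [nE, Expr.eval, h' 0 (by decide) (by decide) (by decide), f₄ 0 rfl, g₃ 0, h0]
    · intro s' h'
      simp [nE, Expr.eval, h' 0 (by decide) (by decide) (by decide), f₄ 0 rfl, g₃ 0, h0]
    · intro i j s'' hi hj h' hu₁ hu₂ h8ij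
      simp only [scaledE, var, Expr.eval, hu₁, hu₂, h' 0 (by decide) (by decide) (by decide),
        h' 3 (by decide) (by decide) (by decide), h' 4 (by decide) (by decide) (by decide),
        h' 6 (by decide) (by decide) (by decide), h' 23 (by decide) (by decide) (by decide),
        hu₃, f₄ 0 rfl, f₄ 3 rfl, f₄ 4 rfl, f₄ 6 rfl, h8ij, hI i hi j hj]
      rw [g₃ 0 (by decide) (by decide) (by decide) (by decide) (by decide),
        g₃ 3 (by decide) (by decide) (by decide) (by decide) (by decide),
        g₃ 4 (by decide) (by decide) (by decide) (by decide) (by decide),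
        h6₃, h0D, h3 k hk i hi, h3 k hk j hj, h4 k hk i hi, h4 k hk j hj, gram, gram,
        sum_range_succ, mul_add]
      rfl
  · rintro s' ⟨hI, f₄⟩
    refine ⟨?_, fun i hi j hj => ?_, hI, ?_⟩
    · rw [f₄ 0 rfl, g₃ 0 (by decide) (by decide) (by decide) (by decide) (by decide), h0]
    · rw [f₄ 7 rfl, h7 i hi j hj]
    · rw [f₄ 9 rfl, h9₃]

/-- The approximation algorithm. -/
def algorithm : Program := .seq prepare solve

/-! ### The scaled instance -/

/-- The extension of a matrix by zero. -/
def ext {m k : ℕ} (M : Matrix (Fin m) (Fin k) ℚ) (i j : ℕ) : ℚ :=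
  if h : i < m ∧ j < k then M ⟨i, h.1⟩ ⟨j, h.2⟩ else 0

theorem ext_of_lt {m k : ℕ} (M : Matrix (Fin m) (Fin k) ℚ) {i j : ℕ} (hi : i < m) (hj : j < k) :
    ext M i j = M ⟨i, hi⟩ ⟨j, hj⟩ := dif_pos ⟨hi, hj⟩

theorem ext_fin {m k : ℕ} (M : Matrix (Fin m) (Fin k) ℚ) (i : Fin m) (j : Fin k) :
    ext M i j = M i j := ext_of_lt M i.2 j.2

theorem tableOf_map {m k : ℕ} (M : Matrix (Fin m) (Fin k) ℚ) (f : ℚ → ℤ) {i j : ℕ} (hi : i < m)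
    (hj : j < k) : tableOf (M.map f) i j = f (ext M i j) := by
  have h : ((0 : ℤ) ≤ i ∧ (i : ℤ) < m) ∧ ((0 : ℤ) ≤ j ∧ (j : ℤ) < k) := by omega
  rw [tableOf, dif_pos h, ext_of_lt M hi hj]
  simp

theorem abs_tableOf_lt {m k : ℕ} {M : Matrix (Fin m) (Fin k) ℤ} {B : ℤ} (hB : 0 < B)
    (h : ∀ i j, |M i j| < B) (i j : ℤ) : |tableOf M i j| < B := by
  unfold tableOf
  split_ifs
  · exact h _ _
  · simpa using hB

theorem scale_cast {D : ℤ} {q : ℚ} (h : (q.den : ℤ) ∣ D) : ((scale D q : ℤ) : ℚ) = D * q := by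
  obtain ⟨k, rfl⟩ := h
  have hd : (q.den : ℤ) ≠ 0 := by exact_mod_cast q.den_nz
  have hd' : (q.den : ℚ) ≠ 0 := by exact_mod_cast q.den_nz
  rw [scale, Int.mul_ediv_cancel_left _ hd]
  push_cast
  calc (q.num : ℚ) * k = (q.den * k) * (q.num / q.den) := by field_simp
    _ = q.den * k * q := by rw [Rat.num_div_den]

theorem abs_scale_le {D B : ℤ} {q : ℚ} (hD : 0 ≤ D) (hDB : D ≤ B) (hq : |q.num| ≤ B) :
    |scale D q| ≤ B ^ 2 := by
  have h1 : 0 ≤ D / (q.den : ℤ) := Int.ediv_nonneg hD (by positivity)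
  have h2 : D / (q.den : ℤ) ≤ D := Int.ediv_le_self _ hD
  rw [scale, abs_mul, abs_of_nonneg h1, pow_two]
  exact mul_le_mul hq (h2.trans hDB) h1 ((abs_nonneg _).trans hq)

theorem prod_le_two_pow {ι : Type*} (s : Finset ι) (f : ι → ℕ) :
    ∏ i ∈ s, f i ≤ 2 ^ ∑ i ∈ s, Nat.size (f i) := by
  rw [← prod_pow_eq_pow_sum]
  exact prod_le_prod' fun i _ => (Nat.lt_size_self _).le

theorem prod_den_ext {m k : ℕ} (M : Matrix (Fin m) (Fin k) ℚ) :
    ∏ i ∈ range m, ∏ j ∈ range k, ((ext M i j).den : ℤ) ≤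
      2 ^ ∑ i, ∑ j, ratLength (M i j) := by
  have h1 : ∏ i ∈ range m, ∏ j ∈ range k, ((ext M i j).den : ℤ) =
      ((∏ i, ∏ j, (M i j).den : ℕ) : ℤ) := by
    rw [prod_range]
    push_cast
    refine prod_congr rfl fun i _ => ?_
    rw [prod_range]
    exact prod_congr rfl fun j _ => by rw [ext_fin]
  rw [h1]
  have h2 : ∏ i, ∏ j, (M i j).den ≤ 2 ^ ∑ i, ∑ j, ratLength (M i j) := by
    rw [← prod_pow_eq_pow_sum]
    refine prod_le_prod' fun i _ => (prod_le_two_pow _ _).trans ?_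
    exact Nat.pow_le_pow_right two_pos (sum_le_sum fun j _ => Nat.le_add_left _ _)
  exact_mod_cast h2

theorem den_ext_dvd {m k : ℕ} (M : Matrix (Fin m) (Fin k) ℚ) (i j : ℕ) :
    ((ext M i j).den : ℤ) ∣ ∏ i ∈ range m, ∏ j ∈ range k, ((ext M i j).den : ℤ) := by
  by_cases h : i < m ∧ j < k
  · exact (dvd_prod_of_mem (fun j => ((ext M i j).den : ℤ)) (mem_range.2 h.2)).trans
      (dvd_prod_of_mem (fun i => ∏ j ∈ range k, ((ext M i j).den : ℤ)) (mem_range.2 h.1))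
  -- Outside the matrix the default value 0 has denominator 1.
  · simp [ext, h]

theorem sum_gram {D d : ℤ} (p : ℕ → ℕ → ℚ) (k : ℕ) (S T : Finset ℕ) :
    ∑ i ∈ S, ∑ j ∈ T, gram D d p k i j =
      d * ∑ l ∈ range k, (∑ i ∈ S, scale D (p l i)) * ∑ j ∈ T, scale D (p l j) := by
  simp_rw [gram, ← mul_sum, sum_mul_sum]
  congr 1
  rw [sum_comm (s := range k)]
  exact sum_congr rfl fun i _ => sum_comm

/-- For each row, let u and v be its sums over `S` and `T`; the inequality is the sum of (2u - v)² ≥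
0 over all rows. -/
theorem crossBound_gram {D d : ℤ} (hd : 0 ≤ d) (p : ℕ → ℕ → ℚ) (k : ℕ) :
    CrossBound (gram D d p k) := by
  intro S T
  have hs : ∀ i j, gram D d p k i j + gram D d p k j i = 2 * gram D d p k i j := by
    intro i j
    have : gram D d p k j i = gram D d p k i j := by
      simp only [gram]
      congr 1
      exact sum_congr rfl fun l _ => mul_comm _ _
    rw [this]
    ring
  simp only [hs, ← mul_sum, quad]
  rw [sum_gram, sum_gram, sum_gram]
  have : 0 ≤ d * ∑ l ∈ range k,
      (2 * ∑ i ∈ S, scale D (p l i) - ∑ i ∈ T, scale D (p l i)) ^ 2 :=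
    mul_nonneg hd (sum_nonneg fun l _ => sq_nonneg _)
  have e : ∑ l ∈ range k, (2 * ∑ i ∈ S, scale D (p l i) - ∑ i ∈ T, scale D (p l i)) ^ 2 =
      4 * ∑ l ∈ range k, (∑ i ∈ S, scale D (p l i)) * ∑ j ∈ S, scale D (p l j) -
      4 * ∑ l ∈ range k, (∑ i ∈ T, scale D (p l i)) * ∑ j ∈ S, scale D (p l j) +
      ∑ l ∈ range k, (∑ i ∈ T, scale D (p l i)) * ∑ j ∈ T, scale D (p l j) := by
    rw [mul_sum, mul_sum, ← sum_sub_distrib, ← sum_add_distrib]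
    exact sum_congr rfl fun l _ => by ring
  rw [e] at this
  linarith

theorem abs_gram_le {D d B : ℤ} {p : ℕ → ℕ → ℚ} {k : ℕ} (hd : 0 ≤ d) (hdB : d ≤ B) (hk : k ≤ B)
    (h : ∀ l i, |scale D (p l i)| ≤ B ^ 2) (i j : ℕ) : |gram D d p k i j| ≤ B ^ 6 := by
  have h1 : |∑ l ∈ range k, scale D (p l i) * scale D (p l j)| ≤ k * B ^ 4 := by
    calc _ ≤ ∑ l ∈ range k, |scale D (p l i) * scale D (p l j)| := abs_sum_le_sum_abs _ _
      _ ≤ ∑ l ∈ range k, B ^ 4 := sum_le_sum fun l _ => by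
          rw [abs_mul, show B ^ 4 = B ^ 2 * B ^ 2 by ring]
          exact mul_le_mul (h l i) (h l j) (abs_nonneg _) (sq_nonneg _)
      _ = k * B ^ 4 := by simp
  have hB : 0 ≤ B := hd.trans hdB
  rw [gram, abs_mul, abs_of_nonneg hd]
  calc _ ≤ B * (B * B ^ 4) := mul_le_mul hdB
        (h1.trans (mul_le_mul_of_nonneg_right hk (by positivity))) (abs_nonneg _) hB
    _ = B ^ 6 := by ring

/-! ### Vectors and sets -/

/-- The 0/1-vector of a set. -/
def chi {n : ℕ} (S : Finset ℕ) (i : Fin n) : ℚ := if (i : ℕ) ∈ S then 1 else 0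

theorem sum_chi_mul {n : ℕ} {S : Finset ℕ} (hS : S ⊆ range n) (f : ℕ → ℚ) :
    ∑ i : Fin n, chi S i * f i = ∑ i ∈ S, f i := by
  have h : ∑ i ∈ S, f i = ∑ i ∈ range n, if i ∈ S then f i else 0 := by
    rw [sum_ite_mem, inter_eq_right.2 hS]
  rw [h, sum_range]
  exact sum_congr rfl fun i _ => by simp [chi]

section

variable (I : MaxSUB)

theorem isBinary_chi (S : Finset ℕ) : I.IsBinary (chi S) := by
  intro i
  unfold chi
  split_ifs
  · exact Or.inr rfl
  · exact Or.inl rfl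

theorem exists_eq_chi {x : Fin I.n → ℚ} (hx : I.IsBinary x) :
    ∃ S ⊆ range I.n, x = chi S := by
  refine ⟨(range I.n).filter fun e => ∃ h : e < I.n, x ⟨e, h⟩ = 1, filter_subset _ _, ?_⟩
  funext i
  have hi := i.2
  rcases hx i with h | h <;> simp [chi, h]

/-- The product of all denominators of an instance. -/
def denom : ℤ := denProd I.n I.K (ext I.A) (ext I.p)

/-- The scaled matrix of the objective. -/
def objMat (i j : ℕ) : ℤ := scale I.denom (ext I.A i j)

/-- The scaled matrix of the constraint. -/
def consMat : ℕ → ℕ → ℤ := gram I.denom I.C.den (ext I.p) I.K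

/-- The scaled budget. -/
def budget : ℤ := I.C.num * (I.denom * I.denom)

theorem denom_pos : 0 < I.denom := denProd_pos _ _ _ _

theorem objMat_cast (i j : ℕ) : ((I.objMat i j : ℤ) : ℚ) = I.denom * ext I.A i j :=
  scale_cast ((den_ext_dvd I.A i j).mul_right _)

theorem scale_p_cast (k j : ℕ) :
    ((scale I.denom (ext I.p k j) : ℤ) : ℚ) = I.denom * ext I.p k j :=
  scale_cast ((den_ext_dvd I.p k j).mul_left _)

theorem quad_objMat {S : Finset ℕ} (hS : S ⊆ range I.n) :
    ((quad I.objMat S : ℤ) : ℚ) = I.denom * I.objective (chi S) := by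
  have h : I.objective (chi S) = ∑ i ∈ S, ∑ j ∈ S, ext I.A i j := by
    rw [← sum_chi_mul hS, objective, dotProduct]
    refine sum_congr rfl fun i _ => ?_
    rw [← sum_chi_mul hS, Matrix.mulVec, dotProduct]
    congr 1
    exact sum_congr rfl fun j _ => by rw [ext_fin, mul_comm]
  rw [h, quad]
  push_cast
  simp only [objMat_cast, mul_sum]

theorem quad_consMat {S : Finset ℕ} (hS : S ⊆ range I.n) :
    ((quad I.consMat S : ℤ) : ℚ) =
      I.C.den * I.denom ^ 2 * ∑ k, (dotProduct (I.p k) (chi S)) ^ 2 := by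
  have h : ∀ k : Fin I.K, dotProduct (I.p k) (chi S) = ∑ j ∈ S, ext I.p k j := by
    intro k
    rw [← sum_chi_mul hS, dotProduct]
    exact sum_congr rfl fun j _ => by rw [ext_fin, mul_comm]
  rw [quad, consMat, sum_gram]
  push_cast
  simp only [scale_p_cast, ← mul_sum, h]
  rw [sum_range (n := I.K), mul_sum, mul_sum]
  exact sum_congr rfl fun k _ => by ring

theorem isFeasible_chi {S : Finset ℕ} (hS : S ⊆ range I.n) :
    I.IsFeasible (chi S) ↔ quad I.consMat S ≤ I.budget := by
  have hD : (0 : ℚ) < I.denom := by exact_mod_cast I.denom_pos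
  have hd : (0 : ℚ) < I.C.den := by exact_mod_cast I.C.den_pos
  have hC : ((I.budget : ℤ) : ℚ) = I.C.den * I.denom ^ 2 * I.C := by
    have : (I.C.num : ℚ) = I.C * I.C.den := (Rat.mul_den_eq_num I.C).symm
    rw [budget]
    push_cast
    rw [this]
    ring
  rw [← Int.cast_le (R := ℚ), quad_consMat I hS, hC, mul_le_mul_iff_right₀ (by positivity)]
  exact and_iff_right (I.isBinary_chi S)

theorem objMat_offDiag (i j : ℕ) (hij : i ≠ j) : I.objMat i j ≤ 0 := by
  have hD : (0 : ℚ) < I.denom := by exact_mod_cast I.denom_pos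
  have h : ext I.A i j ≤ 0 := by
    unfold ext
    split_ifs
    · exact I.offDiag_nonpos _ _ (by simpa using hij)
    · exact le_rfl
  have : ((I.objMat i j : ℤ) : ℚ) ≤ 0 := by
    rw [objMat_cast]
    exact mul_nonpos_of_nonneg_of_nonpos hD.le h
  exact_mod_cast this

theorem consMat_nonneg (i j : ℕ) : 0 ≤ I.consMat i j := by
  have hD : (0 : ℚ) < I.denom := by exact_mod_cast I.denom_pos
  have h : ∀ k j, 0 ≤ scale I.denom (ext I.p k j) := by
    intro k j
    have h : 0 ≤ ext I.p k j := by
      unfold ext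
      split_ifs
      · exact I.p_nonneg _ _
      · exact le_rfl
    have : (0 : ℚ) ≤ (scale I.denom (ext I.p k j) : ℤ) := by
      rw [scale_p_cast]
      exact mul_nonneg hD.le h
    exact_mod_cast this
  exact mul_nonneg (by positivity) (sum_nonneg fun l _ => mul_nonneg (h _ _) (h _ _))

theorem quad_objMat_nonneg (hI : I.NonnegObjective) {S : Finset ℕ} (hS : S ⊆ range I.n)
    (hd : ∀ e ∈ S, 0 ≤ I.objMat e e) : 0 ≤ quad I.objMat S := by
  have hD : (0 : ℚ) < I.denom := by exact_mod_cast I.denom_pos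
  have h := hI (chi S) (I.isBinary_chi S) fun i hi => by
    have : (i : ℕ) ∉ S := by
      intro hiS
      have h1 : (0 : ℚ) ≤ (I.objMat i i : ℤ) := by exact_mod_cast hd i hiS
      rw [objMat_cast, ext_fin] at h1
      exact absurd h1 (not_le.2 (mul_neg_of_pos_of_neg hD hi))
    simp [chi, this]
  have : (0 : ℚ) ≤ (quad I.objMat S : ℤ) := by
    rw [quad_objMat I hS]
    exact mul_nonneg hD.le h
  exact_mod_cast this

/-! ### Word lengths -/

/-- Although `n` itself is written in binary, each diagonal entry of `A` contributes at least one
digit, its denominator being positive. -/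
theorem n_le_length : I.n ≤ I.length := by
  have h1 : ∀ q : ℚ, 1 ≤ ratLength q := fun q =>
    (Nat.size_pos.2 q.den_pos).trans_le (Nat.le_add_left _ _)
  have h2 : I.n ≤ ∑ i, ∑ j, ratLength (I.A i j) := by
    calc I.n = ∑ _i : Fin I.n, 1 := by simp
      _ ≤ ∑ i, ∑ j, ratLength (I.A i j) := sum_le_sum fun i _ =>
          (h1 (I.A i i)).trans (single_le_sum (f := fun j => ratLength (I.A i j))
            (fun _ _ => Nat.zero_le _) (mem_univ i))
  unfold length
  omega

theorem ratLength_A_le (i j : Fin I.n) : ratLength (I.A i j) ≤ I.length := by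
  have h1 : ratLength (I.A i j) ≤ ∑ j, ratLength (I.A i j) :=
    single_le_sum (f := fun j => ratLength (I.A i j)) (fun _ _ => Nat.zero_le _) (mem_univ j)
  have h2 : ∑ j, ratLength (I.A i j) ≤ ∑ i, ∑ j, ratLength (I.A i j) :=
    single_le_sum (f := fun i => ∑ j, ratLength (I.A i j)) (fun _ _ => Nat.zero_le _)
      (mem_univ i)
  unfold length
  omega

theorem ratLength_p_le (i : Fin I.K) (j : Fin I.n) : ratLength (I.p i j) ≤ I.length := by
  have h1 : ratLength (I.p i j) ≤ ∑ j, ratLength (I.p i j) :=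
    single_le_sum (f := fun j => ratLength (I.p i j)) (fun _ _ => Nat.zero_le _) (mem_univ j)
  have h2 : ∑ j, ratLength (I.p i j) ≤ ∑ i, ∑ j, ratLength (I.p i j) :=
    single_le_sum (f := fun i => ∑ j, ratLength (I.p i j)) (fun _ _ => Nat.zero_le _)
      (mem_univ i)
  unfold length
  omega

theorem ratLength_C_le : ratLength I.C ≤ I.length := by
  unfold length
  omega

/-- The lengths of the denominators add up under multiplication, and their sum is part of the input
length; the plain product is therefore short enough as a common denominator. -/
theorem denom_le {L : ℕ} (hL : I.length ≤ L) : I.denom ≤ 2 ^ L := by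
  calc I.denom ≤ 2 ^ (∑ i, ∑ j, ratLength (I.A i j)) * 2 ^ (∑ k, ∑ j, ratLength (I.p k j)) :=
        mul_le_mul (prod_den_ext I.A) (prod_den_ext I.p)
          (prod_nonneg fun _ _ => prod_nonneg fun _ _ => by positivity) (by positivity)
    _ = 2 ^ ((∑ i, ∑ j, ratLength (I.A i j)) + ∑ k, ∑ j, ratLength (I.p k j)) :=
        (pow_add _ _ _).symm
    _ ≤ 2 ^ L := pow_le_pow_right₀ (by norm_num) (by unfold length at hL; omega)

theorem abs_num_lt {q : ℚ} {L : ℕ} (h : ratLength q ≤ L) : |q.num| < 2 ^ L :=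
  bitLength_le_iff.1 ((Nat.le_add_right _ _).trans h)

theorem abs_den_lt {q : ℚ} {L : ℕ} (h : ratLength q ≤ L) : |(q.den : ℤ)| < 2 ^ L :=
  bitLength_le_iff.1 ((Nat.le_add_left _ _ : Nat.size q.den ≤ ratLength q).trans h)

theorem abs_num_ext_le {m k : ℕ} {M : Matrix (Fin m) (Fin k) ℚ} {L : ℕ}
    (h : ∀ i j, ratLength (M i j) ≤ L) (i j : ℕ) : |(ext M i j).num| ≤ 2 ^ L := by
  unfold ext
  split_ifs
  · exact (abs_num_lt (h _ _)).le
  · simp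

theorem bounded_input {ε : ℚ} {L : ℕ} (hL : I.length ≤ L) (hε : ratLength ε ≤ L) :
    Bounded L (I.input ε) := by
  have h2 : (0 : ℤ) < 2 ^ L := by positivity
  have hn : (I.n : ℤ) < 2 ^ L := by
    have := (I.n_le_length.trans hL).trans_lt (Nat.lt_two_pow_self (n := L))
    exact_mod_cast this
  have hK : (I.K : ℤ) < 2 ^ L := lt_of_le_of_lt (by exact_mod_cast I.K_le) hn
  intro t i j
  match t with
  | 0 =>
    refine abs_tableOf_lt h2 (fun i j => ?_) i j
    fin_cases i <;> fin_cases j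
    · simpa using hn
    · simpa using hK
    · exact abs_num_lt (I.ratLength_C_le.trans hL)
    · exact abs_den_lt (I.ratLength_C_le.trans hL)
    · exact abs_num_lt hε
    · exact abs_den_lt hε
  | 1 => exact abs_tableOf_lt h2 (fun i j => abs_num_lt ((I.ratLength_A_le i j).trans hL)) i j
  | 2 => exact abs_tableOf_lt h2 (fun i j => abs_den_lt ((I.ratLength_A_le i j).trans hL)) i j
  | 3 => exact abs_tableOf_lt h2 (fun i j => abs_num_lt ((I.ratLength_p_le i j).trans hL)) i j
  | 4 => exact abs_tableOf_lt h2 (fun i j => abs_den_lt ((I.ratLength_p_le i j).trans hL)) i j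
  | _ + 5 => simp [input]

theorem scaled {L : ℕ} (hL : I.length ≤ L) :
    Scaled I.n I.objMat I.consMat I.budget (8 * L + 3) ∧ |I.budget| < 2 ^ (8 * L + 3) ∧
      I.denom < 2 ^ (8 * L + 3) ∧ (∀ i j, |I.objMat i j| < 2 ^ (8 * L + 3)) ∧
      ∀ k ≤ I.K, ∀ i j, |gram I.denom I.C.den (ext I.p) k i j| < 2 ^ (8 * L + 3) := by
  obtain ⟨B, hB⟩ : ∃ B : ℤ, B = 2 ^ L := ⟨_, rfl⟩
  have hB1 : 1 ≤ B := hB ▸ one_le_pow₀ (by norm_num)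
  -- The largest bound needed is 3 B⁷, for the marginals of the constraint matrix; 8 B⁸ leaves room
  -- for all of them.
  have hβ : (2 : ℤ) ^ (8 * L + 3) = 8 * B ^ 8 := by rw [hB, pow_add, mul_comm 8 L, pow_mul]; ring
  have hpow : ∀ k ≤ 8, B ^ k ≤ B ^ 8 := fun k hk => pow_le_pow_right₀ hB1 hk
  have hB8 : 1 ≤ B ^ 8 := one_le_pow₀ hB1
  have hn : (I.n : ℤ) ≤ B := by
    have := (I.n_le_length.trans hL).trans (Nat.lt_two_pow_self (n := L)).le
    rw [hB]
    exact_mod_cast this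
  have hK : (I.K : ℤ) ≤ B := le_trans (by exact_mod_cast I.K_le) hn
  have hD : I.denom ≤ B := hB ▸ I.denom_le hL
  have hD0 := I.denom_pos
  have hC : |I.C.num| ≤ B := hB ▸ (abs_num_lt (I.ratLength_C_le.trans hL)).le
  have hCd : (I.C.den : ℤ) ≤ B :=
    hB ▸ (le_abs_self _).trans (abs_den_lt (I.ratLength_C_le.trans hL)).le
  have ha : ∀ i j, |I.objMat i j| ≤ B ^ 2 := fun i j => abs_scale_le hD0.le hD
    (hB ▸ abs_num_ext_le (fun i j => (I.ratLength_A_le i j).trans hL) i j)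
  have hp : ∀ i j, |scale I.denom (ext I.p i j)| ≤ B ^ 2 := fun i j => abs_scale_le hD0.le hD
    (hB ▸ abs_num_ext_le (fun i j => (I.ratLength_p_le i j).trans hL) i j)
  have hQ : ∀ k ≤ I.K, ∀ i j, |gram I.denom I.C.den (ext I.p) k i j| ≤ B ^ 6 :=
    fun k hk => abs_gram_le (by positivity) hCd (le_trans (by exact_mod_cast hk) hK) hp
  have hc : |I.budget| ≤ B ^ 3 := by
    rw [budget, abs_mul, abs_of_pos (mul_pos hD0 hD0), show B ^ 3 = B * (B * B) by ring]
    gcongr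
  have hn1 : (2 * I.n + 1 : ℤ) ≤ 3 * B := by linarith
  have hcpos : 0 < I.budget := mul_pos (Rat.num_pos.2 I.C_pos) (mul_pos hD0 hD0)
  have e1 := hpow 1 (by norm_num)
  have e2 := hpow 2 (by norm_num)
  have e3 := hpow 3 (by norm_num)
  have e4 := hpow 4 (by norm_num)
  have e6 := hpow 6 (by norm_num)
  have e7 := hpow 7 (by norm_num)
  rw [pow_one] at e1
  rw [hβ]
  refine ⟨⟨?_, I.objMat_offDiag, I.consMat_nonneg, crossBound_gram (by positivity) _ _, hcpos,
    ?_, ?_, fun S hS => ?_, fun e S hS => ?_, fun e S hS => ?_⟩, by linarith, by linarith,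
    fun i j => (ha i j).trans_lt (by linarith), fun k hk i j => (hQ k hk i j).trans_lt (by linarith)⟩
  all_goals rw [hβ]
  · linarith
  · linarith [le_abs_self I.budget]
  · linarith
  · refine (abs_quad_le ha hS).trans_lt ?_
    have : (I.n : ℤ) ^ 2 * B ^ 2 ≤ B ^ 2 * B ^ 2 := by gcongr
    linarith [show B ^ 2 * B ^ 2 = B ^ 4 by ring]
  · refine (abs_marg_le ha e hS).trans_lt ?_
    have : (2 * I.n + 1 : ℤ) * B ^ 2 ≤ 3 * B * B ^ 2 := by gcongr
    linarith [show 3 * B * B ^ 2 = 3 * B ^ 3 by ring]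
  · refine (abs_marg_le (hQ I.K le_rfl) e hS).trans_lt ?_
    have : (2 * I.n + 1 : ℤ) * B ^ 6 ≤ 3 * B * B ^ 6 := by gcongr
    linarith [show 3 * B * B ^ 6 = 3 * B ^ 7 by ring]

/-! ### The algorithm on rational instances and its ratio -/

theorem exec_algorithm {ε : ℚ} {L : ℕ} (hI : I.NonnegObjective) (hL : I.length ≤ L)
    (hε : ratLength ε ≤ L) :
    ∃ t s, Run algorithm (I.input ε) t s ∧
      t ≤ 200 * (L + 1) ^ 3 * (algorithm.weight * (8 * L + 5)) ∧
      ∃ b, Out I.n I.objMat I.consMat I.budget b s ∧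
        ∀ O ⊆ range I.n, quad I.consMat O ≤ I.budget → quad I.objMat O ≤ 14 * b := by
  obtain ⟨hP, hc, hD, ha, hQ⟩ := I.scaled hL
  have hK : (I.K : ℤ) < 2 ^ (8 * L + 3) := lt_of_le_of_lt (by exact_mod_cast I.K_le) hP.n_lt
  have hb : Bounded (8 * L + 3) (I.input ε) := fun t i j =>
    (I.bounded_input hL hε t i j).trans_le (pow_le_pow_right₀ (by norm_num) (by omega))
  have hE : Exec (8 * L + 3) algorithm (I.input ε)
      (2 * (I.n * (3 * I.n + 4)) + I.K * (3 * I.n + 4) + I.K * (I.n * (3 * I.n + 4) + 4) + 10 +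
        (27 * I.n ^ 2 + 76 * I.n + 38))
      fun s => ∃ b, Out I.n I.objMat I.consMat I.budget b s ∧
        ∀ O ⊆ range I.n, quad I.consMat O ≤ I.budget → quad I.objMat O ≤ 14 * b := by
    refine Exec.seq (exec_prepare (n := I.n) (K := I.K) (A := ext I.A) (p := ext I.p) (C := I.C)
      rfl rfl rfl rfl (fun i hi j hj => tableOf_map I.A _ hi hj)
      (fun i hi j hj => tableOf_map I.A _ hi hj) (fun i hi j hj => tableOf_map I.p _ hi hj)
      (fun i hi j hj => tableOf_map I.p _ hi hj) (fun i j => rfl) hP.n_lt hK hP.one_lt hD hc ha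
      hQ) fun s f hr => ?_
    refine exec_solve hP hr (fun S hS hd => I.quad_objMat_nonneg hI hS hd) ?_ ?_
    · intro t i j h1 h2
      have : t = 10 ∨ t = 11 ∨ t = 12 := by omega
      rcases this with rfl | rfl | rfl <;> rw [f _ rfl] <;> rfl
    · intro i j
      rw [f 5 rfl]
      rfl
  obtain ⟨t, s, h1, h2, -, h3⟩ := hE hb
  refine ⟨t, s, h1, h2.trans (Nat.mul_le_mul_right _ ?_), h3⟩
  have hn : I.n ≤ L := I.n_le_length.trans hL
  have hK' := I.K_le
  calc _ ≤ 2 * (I.n * (3 * I.n + 4)) + I.n * (3 * I.n + 4) + I.n * (I.n * (3 * I.n + 4) + 4) + 10 +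
        (27 * I.n ^ 2 + 76 * I.n + 38) := by gcongr
    _ ≤ 200 * (I.n + 1) ^ 3 := by ring_nf; omega
    _ ≤ 200 * (L + 1) ^ 3 := by gcongr

theorem isApproxSolution_output {s : Memory} {b : ℤ} {α : ℝ} (hα : α ≤ 1 / 14)
    (hs : Out I.n I.objMat I.consMat I.budget b s)
    (hb : ∀ O ⊆ range I.n, quad I.consMat O ≤ I.budget → quad I.objMat O ≤ 14 * b) :
    I.IsApproxSolution α (I.output s) := by
  obtain ⟨-, X, hX, hQX, rfl, h5⟩ := hs
  have hout : I.output s = chi X := by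
    funext i
    rw [output, h5 i i.2, chi, ind]
    split_ifs <;> simp
  have hD : (0 : ℚ) < I.denom := by exact_mod_cast I.denom_pos
  have h0 : ∅ ∈ (range I.n).powerset.filter fun S => quad I.consMat S ≤ I.budget := by
    refine mem_filter.2 ⟨by simp, ?_⟩
    rw [quad_empty]
    exact (mul_pos (Rat.num_pos.2 I.C_pos) (mul_pos I.denom_pos I.denom_pos)).le
  obtain ⟨O, hO, hmax⟩ := exists_max_image _ (quad I.objMat) ⟨∅, h0⟩
  obtain ⟨hO1, hO2⟩ := mem_filter.1 hO
  rw [mem_powerset] at hO1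
  have hle : ∀ S ⊆ range I.n, ∀ T ⊆ range I.n, ∀ k : ℕ, quad I.objMat S ≤ k * quad I.objMat T →
      I.objective (chi S) ≤ k * I.objective (chi T) := by
    intro S hS T hT k h
    have h' : ((quad I.objMat S : ℤ) : ℚ) ≤ k * (quad I.objMat T : ℤ) := by exact_mod_cast h
    rw [quad_objMat I hS, quad_objMat I hT, mul_left_comm] at h'
    exact le_of_mul_le_mul_left h' hD
  rw [hout]
  refine ⟨(I.isFeasible_chi hX).2 hQX, I.objective (chi O),
    ⟨⟨chi O, (I.isFeasible_chi hO1).2 hO2, rfl⟩, ?_⟩, ?_⟩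
  · rintro _ ⟨x, hx, rfl⟩
    obtain ⟨S, hS, rfl⟩ := I.exists_eq_chi hx.1
    have := hle S hS O hO1 1 (by
      simpa using hmax S (mem_filter.2 ⟨mem_powerset.2 hS, (I.isFeasible_chi hS).1 hx⟩))
    simpa using this
  · have h14 : ((I.objective (chi O) : ℚ) : ℝ) ≤ 14 * (I.objective (chi X) : ℚ) := by
      exact_mod_cast hle O hO1 X hX 14 (by simpa using hb O hO1 hO2)
    -- The empty set is feasible with value 0. Non-negativity of the optimum is what permits
    -- replacing `α` by 1/14, also when `α` is negative.
    have hpos : (0 : ℝ) ≤ (I.objective (chi O) : ℚ) := by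
      have h := hmax ∅ h0
      rw [quad_empty] at h
      have h' : (0 : ℚ) ≤ (quad I.objMat O : ℤ) := by exact_mod_cast h
      rw [quad_objMat I hO1] at h'
      exact_mod_cast nonneg_of_mul_nonneg_right h' hD
    calc α * (I.objective (chi O) : ℚ) ≤ 1 / 14 * (I.objective (chi O) : ℚ) := by gcongr
      _ ≤ (I.objective (chi X) : ℚ) := by linarith

end

/-- The margin is small: 14 φ² ≈ 5.348 against 2e ≈ 5.437. With the constant 15 in place of 14 the
inequality would fail. -/
theorem golden_ratio_sq_div_le : (2 / (1 + Real.sqrt 5)) ^ 2 / (2 * Real.exp 1) ≤ 1 / 14 := by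
  have h5 : (2.236 : ℝ) < Real.sqrt 5 := Real.lt_sqrt_of_sq_lt (by norm_num)
  have he := Real.exp_one_gt_d9
  have h1 : 2 / (1 + Real.sqrt 5) ≤ 2 / 3.236 := by
    apply div_le_div_of_nonneg_left <;> linarith
  have h2 : (2 / (1 + Real.sqrt 5)) ^ 2 ≤ (2 / 3.236) ^ 2 := by
    apply pow_le_pow_left₀ (by positivity) h1
  rw [div_le_div_iff₀ (by positivity) (by norm_num)]
  norm_num at h2 ⊢
  linarith

end MaxSUB

theorem theorem4 :
    ∃ (c : RAM.Program) (M : ℝ), 0 < M ∧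
      IsApproxAlgorithm c
        (fun ε => (2 / (1 + Real.sqrt 5)) ^ 2 / (2 * Real.exp 1) - M * (ε : ℝ)) := by
  -- The ratio 1/14 is reached without any loss in ε, so subtracting `M * ε` only weakens the claim
  -- and every positive `M` would serve. The polynomial is the cost bound of `exec_algorithm`.
  refine ⟨MaxSUB.algorithm, 1, one_pos,
    200 * (Polynomial.X + 1) ^ 3 *
      (Polynomial.C MaxSUB.algorithm.weight * (8 * Polynomial.X + 5)), ?_⟩
  intro I ε hI hε
  obtain ⟨t, s, hrun, ht, b, hout, hb⟩ := I.exec_algorithm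
    (ε := ε) (L := I.length + MaxSUB.ratLength ε + ⌈1 / ε⌉₊) hI (by omega) (by omega)
  refine ⟨t, s, hrun, ht.trans (le_of_eq ?_), I.isApproxSolution_output ?_ hout hb⟩
  · simp
  · have hε' : (0 : ℝ) < ε := by exact_mod_cast hε
    linarith [MaxSUB.golden_ratio_sq_div_le]
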